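/- Let $L$ be a separable complex Hilbert space with a conjugation $f\mapsto\bar f$ (an antilinear isometric involution); inner products are linear in the second argument. Let $a,a^\dagger$ be a Fock representation of the canonical anti-commutation relations over $L$ on a complex Hilbert space $\mathcal F$: $f\mapsto a(f)$ and $f\mapsto a^\dagger(f)$ are linear maps into the linear operators on a common dense invariant domain $D\subset\mathcal F$ such that, on $D$ and for all $f,g\in L$, $\{a(f),a(g)\}=0=\{a^\dagger(f),a^\dagger(g)\}$, $\{a(f),a^\dagger(g)\}=(\bar f,g)\,1$, and $a(f)^*=a^\dagger(\bar f)$ (these operators are bounded and are extended by continuity to $\mathcal F$); and there is a vacuum $\Omega\in\mathcal F$, $\|\Omega\|=1$, with $a(f)\Omega=0$ for all $f\in L$, such that the vectors $a^\dagger(f_n)\cdots a^\dagger(f_1)\Omega$, $n\ge 0$, span a dense subspace of $\mathcal F$. Let $\mathcal F^{(n)}$ be the closed linear span of the vectors $a^\dagger(f_n)\cdots a^\dagger(f_1)\Omega$ with $n$ factors, and let $\mathcal F_0$ be the (algebraic) linear span of all $\mathcal F^{(n)}$, $n\ge0$. For a bounded operator $B$ on $L$ and a complete orthonormal system $\{e_j\}$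 of $L$ let $d\Gamma(B)=\sum_j a^\dagger(Be_j)a(\bar e_j)$ on $\mathcal F_0$, and let $N=d\Gamma(1)$ be the number operator. For $s\ge0$ let $N^s$ be the power of $N$ on $\mathcal F_0$, i.e. the linear operator with $N^s\Phi=\lambda^s\Phi$ whenever $N\Phi=\lambda\Phi$, $\lambda\geq 0$ (with $0^0=1$). For $1\le r<\infty$ let $B_r(L)$ be the von Neumann--Schatten class of all bounded operators $B$ on $L$ with $\|B\|_r=(\operatorname{tr}|B|^r)^{1/r}<\infty$, and let $B_\infty(L)$ be the bounded operators with the operator norm $\|\cdot\|_\infty$. Let $1\le r\le\infty$, $B\in B_r(L)$, and $s=\frac{2(r-1)}{r}$ ($s=2$ for $r=\infty$). Then the series for $d\Gamma(B)$ converges on $\mathcal F_0$, and on $\mathcal F_0$, in the sense of quadratic forms, $$ d\Gamma(B)^*d\Gamma(B)\le \begin{cases} \|B\|_r^2\,N^s+\|B\|_2^2\,1 & \text{if } 1<r<2,\\ \|B\|_r^2\,N^s & \text{if } r=1\text{ or } 2\le r\le\infty, \end{cases} $$ where in the first case also $B\in B_2(L)$, so that $\|B\|_2$ is finite. -/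

import Mathlib

open scoped NNReal ENNReal ComplexOrder LinearPMap

noncomputable section

/-! ### Schatten classes -/

section Schatten

variable {L : Type*} [NormedAddCommGroup L] [InnerProductSpace ℂ L] [CompleteSpace L]

/-- The trace `∑ᵢ ⟪bᵢ, T bᵢ⟫ ∈ [0, ∞]` of a non-negative bounded operator, computed in some
orthonormal basis of `L` (for `T ≥ 0` the value does not depend on the basis). -/
def posTrace (T : L →L[ℂ] L) : ℝ≥0∞ :=
  let b := (exists_hilbertBasis ℂ L).choose_spec.choose
  ∑' i, ENNReal.ofReal (inner ℂ (b i) (T (b i))).re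

/-- The von Neumann–Schatten norm of a bounded operator as an extended non-negative number:
`‖B‖_r = (tr |B|^r)^(1/r)` for finite `r`, and the operator norm for `r = ∞`. -/
def schattenENorm (r : ℝ≥0∞) (B : L →L[ℂ] L) : ℝ≥0∞ :=
  if r = ⊤ then ‖B‖ₑ
  else posTrace (CFC.abs B ^ r.toNNReal) ^ (1 / r.toReal)

/-- Membership in the von Neumann–Schatten class `B_r(L)`; `B_∞(L)` consists of all bounded
operators. -/
def MemSchatten (r : ℝ≥0∞) (B : L →L[ℂ] L) : Prop := schattenENorm r B < ⊤

/-- The Schatten norm `‖B‖_r` as a real number. -/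
def schattenNorm (r : ℝ≥0∞) (B : L →L[ℂ] L) : ℝ := (schattenENorm r B).toReal

end Schatten

/-! ### Partially defined operators -/

section PartialOperators

variable {F : Type*} [NormedAddCommGroup F] [InnerProductSpace ℂ F]

/-- The product `S T` of two partially defined operators, on its natural domain
`{x ∈ dom T | T x ∈ dom S}`. -/
def pmapMul (S T : F →ₗ.[ℂ] F) : F →ₗ.[ℂ] F :=
  S.comp (T.domRestrict ((S.domain.comap T.toFun).map T.domain.subtype)) (by
    rintro ⟨x, ⟨y, hy, rfl⟩, hx⟩
    exact hy)

/-- The operator inequality `S ≤ T` on the subspace `D`: both operators are defined on `D`, and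
`⟪x, S x⟫ ≤ ⟪x, T x⟫` for all `x ∈ D`. (In the order of `ℂ`, `z ≤ w` says that `w - z` is real
and non-negative.) -/
def OpLEOn (D : Submodule ℂ F) (S T : F →ₗ.[ℂ] F) : Prop :=
  ∃ (hS : D ≤ S.domain) (hT : D ≤ T.domain), ∀ x : D,
    inner ℂ (x : F) (S ⟨x, hS x.2⟩) ≤ inner ℂ (x : F) (T ⟨x, hT x.2⟩)

/-- The power `T^s` of a non-negative operator `T` on the span of its eigenvectors: the linear
operator with `T^s x = λ^s x` whenever `T x = λ x`, `λ ≥ 0`, given by its graph. Here `0^0 = 1`,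
so that `T^0` is the identity. -/
def pmapPow (T : F →ₗ.[ℂ] F) (s : ℝ) : F →ₗ.[ℂ] F :=
  (Submodule.span ℂ {p : F × F | ∃ (c : ℝ) (x : T.domain), 0 ≤ c ∧ T x = (c : ℂ) • (x : F) ∧
    p = ((x : F), ((c ^ s : ℝ) : ℂ) • (x : F))}).toLinearPMap

end PartialOperators

/-! ### The canonical anti-commutation relations and the Fock representation -/

/-- A conjugation of a complex Hilbert space: an antilinear isometric involution. -/
structure Conjugation (L : Type*) [NormedAddCommGroup L] [InnerProductSpace ℂ L] where
  toMap : L →ₛₗᵢ[starRingEnd ℂ] L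
  involutive : ∀ f, toMap (toMap f) = f

/-- A representation of the canonical anti-commutation relations over `L` (with conjugation `J`)
on the Hilbert space `F`: operator-valued functionals `a`, `aDag`, linear in `f ∈ L`, with a common
dense invariant domain `D`. -/
structure CARRep {L : Type*} [NormedAddCommGroup L] [InnerProductSpace ℂ L] (J : Conjugation L)
    (F : Type*) [NormedAddCommGroup F] [InnerProductSpace ℂ F] where
  D : Submodule ℂ F
  dense : Dense (D : Set F)
  a : L →ₗ[ℂ] D →ₗ[ℂ] D
  aDag : L →ₗ[ℂ] D →ₗ[ℂ] D
  car_a : ∀ f g Φ, a f (a g Φ) + a g (a f Φ) = 0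
  car_aDag : ∀ f g Φ, aDag f (aDag g Φ) + aDag g (aDag f Φ) = 0
  car_mixed : ∀ f g Φ, a f (aDag g Φ) + aDag g (a f Φ) = inner ℂ (J.toMap f) g • Φ
  unitarity : ∀ f (Φ Ψ : D), inner ℂ (a f Φ : F) (Ψ : F) = inner ℂ (Φ : F) (aDag (J.toMap f) Ψ : F)

namespace CARRep

variable {L : Type*} [NormedAddCommGroup L] [InnerProductSpace ℂ L] {J : Conjugation L}
  {F : Type*} [NormedAddCommGroup F] [InnerProductSpace ℂ F]

theorem norm_sq_add_norm_sq (R : CARRep J F) (f : L) (Φ : R.D) :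
    ‖(R.a f Φ : F)‖ ^ 2 + ‖(R.aDag (J.toMap f) Φ : F)‖ ^ 2 = ‖f‖ ^ 2 * ‖(Φ : F)‖ ^ 2 := by
  have h := congrArg (fun x : R.D => inner ℂ (Φ : F) (x : F)) (R.car_mixed f (J.toMap f) Φ)
  simp only [Submodule.coe_add, Submodule.coe_smul, inner_add_right, inner_smul_right] at h
  rw [← R.unitarity f Φ (R.a f Φ)] at h
  have h2 := R.unitarity f (R.aDag (J.toMap f) Φ) Φ
  have h3 : inner ℂ (Φ : F) (R.a f (R.aDag (J.toMap f) Φ) : F)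
      = inner ℂ (R.aDag (J.toMap f) Φ : F) (R.aDag (J.toMap f) Φ : F) := by
    rw [← inner_conj_symm, h2, inner_conj_symm]
  rw [h3, inner_self_eq_norm_sq_to_K, inner_self_eq_norm_sq_to_K, inner_self_eq_norm_sq_to_K,
    inner_self_eq_norm_sq_to_K, J.toMap.norm_map] at h
  have h4 : ‖(R.aDag (J.toMap f) Φ : F)‖ ^ 2 + ‖(R.a f Φ : F)‖ ^ 2 = ‖f‖ ^ 2 * ‖(Φ : F)‖ ^ 2 := by
    exact_mod_cast h
  linarith

theorem norm_a_le (R : CARRep J F) (f : L) (Φ : R.D) : ‖(R.a f Φ : F)‖ ≤ ‖f‖ * ‖(Φ : F)‖ := by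
  have h := R.norm_sq_add_norm_sq f Φ
  refine abs_le_of_sq_le_sq' ?_ (by positivity) |>.2
  nlinarith [sq_nonneg ‖(R.aDag (J.toMap f) Φ : F)‖]

theorem norm_aDag_le (R : CARRep J F) (f : L) (Φ : R.D) :
    ‖(R.aDag f Φ : F)‖ ≤ ‖f‖ * ‖(Φ : F)‖ := by
  have h := R.norm_sq_add_norm_sq (J.toMap f) Φ
  rw [J.involutive, J.toMap.norm_map] at h
  refine abs_le_of_sq_le_sq' ?_ (by positivity) |>.2
  nlinarith [sq_nonneg ‖(R.a (J.toMap f) Φ : F)‖]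

variable [CompleteSpace F]

/-- The annihilation operator `a(f)`, extended by continuity from `D` to all of `F`. -/
def ann (R : CARRep J F) (f : L) : F →L[ℂ] F :=
  (R.D.subtype ∘ₗ R.a f).extendOfNorm R.D.subtype

/-- The creation operator `a†(f)`, extended by continuity from `D` to all of `F`. -/
def cre (R : CARRep J F) (f : L) : F →L[ℂ] F :=
  (R.D.subtype ∘ₗ R.aDag f).extendOfNorm R.D.subtype

theorem ann_coe (R : CARRep J F) (f : L) (Φ : R.D) : R.ann f Φ = R.a f Φ :=
  LinearMap.extendOfNorm_eq R.dense.denseRange_val ⟨‖f‖, R.norm_a_le f⟩ Φ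

theorem cre_coe (R : CARRep J F) (f : L) (Φ : R.D) : R.cre f Φ = R.aDag f Φ :=
  LinearMap.extendOfNorm_eq R.dense.denseRange_val ⟨‖f‖, R.norm_aDag_le f⟩ Φ

end CARRep

/-- The vector `a†(f_n) ⋯ a†(f_1) Ω` for the list `[f_n, …, f_1]`. -/
def CARRep.createFrom {L : Type*} [NormedAddCommGroup L] [InnerProductSpace ℂ L]
    {J : Conjugation L} {F : Type*} [NormedAddCommGroup F] [InnerProductSpace ℂ F]
    [CompleteSpace F] (R : CARRep J F) (Ω : F) (l : List L) : F :=
  l.foldr (fun f Φ => R.cre f Φ) Ω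

/-- A Fock representation of the canonical anti-commutation relations: there is a normalized
vacuum vector that is annihilated by all `a(f)` and cyclic for the `a†(f)`. -/
structure FockRep {L : Type*} [NormedAddCommGroup L] [InnerProductSpace ℂ L] (J : Conjugation L)
    (F : Type*) [NormedAddCommGroup F] [InnerProductSpace ℂ F] [CompleteSpace F]
    extends CARRep J F where
  Ω : F
  norm_vacuum : ‖Ω‖ = 1
  ann_vacuum : ∀ f, toCARRep.ann f Ω = 0
  cyclic : (Submodule.span ℂ (Set.range (toCARRep.createFrom Ω))).topologicalClosure = ⊤

namespace FockRep

variable {L : Type*} [NormedAddCommGroup L] [InnerProductSpace ℂ L] {J : Conjugation L}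
  {F : Type*} [NormedAddCommGroup F] [InnerProductSpace ℂ F] [CompleteSpace F]

/-- The `n`-particle space, the closed span of the vectors `a†(f_n) ⋯ a†(f_1) Ω`. -/
def particleSpace (R : FockRep J F) (n : ℕ) : Submodule ℂ F :=
  (Submodule.span ℂ (R.createFrom R.Ω '' {l : List L | l.length = n})).topologicalClosure

/-- The subspace of finite particle numbers, the (algebraic) span of all `n`-particle spaces. -/
def finiteParticle (R : FockRep J F) : Submodule ℂ F := ⨆ n, R.particleSpace n

/-- The `j`-th term `a†(B e_j) a(ē_j) Φ` of the series for `dΓ(B) Φ`. -/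
def dGammaTerm (R : FockRep J F) {ι : Type*} (e : ι → L) (B : L →L[ℂ] L) (Φ : F) (j : ι) : F :=
  R.cre (B (e j)) (R.ann (J.toMap (e j)) Φ)

/-- The second quantization `dΓ(B) = ∑_j a†(B e_j) a(ē_j)`, where `{e_j}` is a complete orthonormal
system. Its domain consists of the finite particle vectors on which the series converges. -/
def dGamma (R : FockRep J F) {ι : Type*} (e : HilbertBasis ι ℂ L) (B : L →L[ℂ] L) :
    F →ₗ.[ℂ] F where
  domain :=
    { carrier := {Φ | Φ ∈ R.finiteParticle ∧ Summable (R.dGammaTerm e B Φ)}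
      add_mem' := fun {Φ Ψ} h h' => ⟨add_mem h.1 h'.1, by
        have := h.2.add h'.2
        refine this.congr fun j => ?_
        simp [dGammaTerm]⟩
      zero_mem' := ⟨zero_mem _, by
        refine summable_zero.congr fun j => ?_
        simp [dGammaTerm]⟩
      smul_mem' := fun c {Φ} h => ⟨Submodule.smul_mem _ c h.1, by
        have := h.2.const_smul c
        refine this.congr fun j => ?_
        simp [dGammaTerm]⟩ }
  toFun :=
    { toFun := fun Φ => ∑' j, R.dGammaTerm e B Φ j
      map_add' := fun Φ Ψ => by
        rw [← Φ.2.2.tsum_add Ψ.2.2]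
        exact tsum_congr fun j => by simp [dGammaTerm]
      map_smul' := fun c Φ => by
        rw [RingHom.id_apply, ← Φ.2.2.tsum_const_smul c]
        exact tsum_congr fun j => by simp [dGammaTerm] }

/-- The number operator `N = dΓ(1)`. -/
def number (R : FockRep J F) {ι : Type*} (e : HilbertBasis ι ℂ L) : F →ₗ.[ℂ] F :=
  R.dGamma e (ContinuousLinearMap.id ℂ L)

end FockRep

/-- The exponent `s = 2(r-1)/r`, with `s = 2` for `r = ∞`. -/
def numberExponent (r : ℝ≥0∞) : ℝ := if r = ⊤ then 2 else 2 * (r.toReal - 1) / r.toReal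

end

universe u

/-! ### Square summable families and Hilbert–Schmidt operators -/

/-! Since `dΓ(B)` preserves each `n`-particle space and these spaces are mutually orthogonal,
everything reduces to `‖dΓ(B) x‖ ≤ ‖B‖_r n^(1-1/r) ‖x‖` for `x` in the `n`-particle space; squaring
gives `n^s` with `s = 2(1-1/r)`, and Pythagoras sums over `n`.

For finite `r`, use the singular value decomposition `B v_k = s_k u_k`. Pairing `dΓ(B) x` with an
`n`-particle vector `y` bounds it by `∑ s_k α_k β_k`, where `α_k = ‖a(ū_k) y‖` and `β_k = ‖a(v̄_k)
x‖`. The anticommutation relations give `α_k ≤ ‖y‖` and `β_k ≤ ‖x‖`; the number operator gives `∑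
α_k² ≤ n‖y‖²` and `∑ β_k² ≤ n‖x‖²`. Hölder's inequality interpolates between these bounds
(`sum_mul_mul_le_of_sum_sq_le`, `sum_norm_ann_mul_norm_ann_le`). For `r = ∞`, Cauchy–Schwarz and a
Hilbert–Schmidt estimate in the given basis suffice (`norm_sum_dGammaTerm_le`).

The singular basis differs from the basis defining `dΓ(B)`. On the algebraic span of the creation
vectors the Leibniz rule shows independence of the basis; the cruder bound `n‖B‖‖x‖` carries the
estimate to the closure. The estimate holds for every `r ≥ 1`, so the term `‖B‖_2²` is only a
nonnegative addition. -/

theorem summable_of_norm_sum_sq_le {ι E : Type*} [NormedAddCommGroup E] [CompleteSpace E]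
    {f : ι → E} {g : ι → ℝ} (hg : Summable g) (K : ℝ)
    (h : ∀ t : Finset ι, ‖∑ i ∈ t, f i‖ ^ 2 ≤ K * ∑ i ∈ t, g i) : Summable f := by
  rw [summable_iff_vanishing_norm] at hg ⊢
  intro ε hε
  -- Cauchy criterion: tails of `g` below `ε²/(|K|+1)` force tails of `f` below `ε`; the `+1` covers
  -- `K = 0`.
  obtain ⟨s, hs⟩ := hg (ε ^ 2 / (|K| + 1)) (by positivity)
  refine ⟨s, fun t ht => ?_⟩
  have h1 := h t
  have h2 := hs t ht
  rw [Real.norm_eq_abs, lt_div_iff₀ (by positivity)] at h2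
  have h3 : K * ∑ i ∈ t, g i ≤ |K| * |∑ i ∈ t, g i| := by
    rw [← abs_mul]; exact le_abs_self _
  refine lt_of_pow_lt_pow_left₀ 2 hε.le ?_
  nlinarith [abs_nonneg (∑ i ∈ t, g i)]

section HilbertSchmidt

variable {E G : Type*} [NormedAddCommGroup E] [InnerProductSpace ℂ E]
  [NormedAddCommGroup G] [InnerProductSpace ℂ G]

theorem HilbertBasis.hasSum_norm_inner_sq {ι : Type*} (b : HilbertBasis ι ℂ E) (x : E) :
    HasSum (fun i => ‖inner ℂ (b i) x‖ ^ 2) (‖x‖ ^ 2) := by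
  have h := b.hasSum_inner_mul_inner x x
  have h2 := (Complex.reCLM.hasSum h)
  have h3 : Complex.reCLM (inner ℂ x x) = ‖x‖ ^ 2 := by
    rw [inner_self_eq_norm_sq_to_K]; norm_cast
  rw [h3] at h2
  refine h2.congr_fun fun i => ?_
  rw [← inner_conj_symm x, Complex.reCLM_apply, ← Complex.normSq_eq_conj_mul_self,
    Complex.ofReal_re, Complex.normSq_eq_norm_sq]

theorem HilbertBasis.tsum_enorm_inner_sq {ι : Type*} (b : HilbertBasis ι ℂ E) (x : E) :
    ∑' i, ‖inner ℂ (b i) x‖ₑ ^ 2 = ‖x‖ₑ ^ 2 := by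
  have h := b.hasSum_norm_inner_sq x
  have h2 := ENNReal.ofReal_tsum_of_nonneg (fun i => by positivity) h.summable
  rw [h.tsum_eq] at h2
  simp only [ENNReal.ofReal_pow (norm_nonneg _), ofReal_norm] at h2
  exact h2.symm

variable [CompleteSpace G]

/-- By Parseval both sides are the double sum of `|⟪x_k, T b_i⟫|²`, and extended nonnegative sums
may be interchanged. This is the source of basis independence of the trace. -/
theorem tsum_enorm_sq_adjoint [CompleteSpace E] {ι κ : Type*} (b : HilbertBasis ι ℂ E)
    (x : HilbertBasis κ ℂ G) (T : E →L[ℂ] G) :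
    ∑' i, ‖T (b i)‖ₑ ^ 2 = ∑' k, ‖T.adjoint (x k)‖ₑ ^ 2 := by
  simp_rw [← x.tsum_enorm_inner_sq, ← b.tsum_enorm_inner_sq]
  rw [ENNReal.tsum_comm]
  refine tsum_congr fun k => tsum_congr fun i => ?_
  rw [← ContinuousLinearMap.adjoint_inner_left, ← inner_conj_symm, RCLike.enorm_conj]

/-- Cauchy–Schwarz and Bessel make the rank-one expansion `∑ ⟪b_i, ·⟫ T b_i` converge in operator
norm, so `T` is a norm limit of finite rank operators. -/
theorem isCompactOperator_of_summable_norm_sq {ι : Type*} (b : HilbertBasis ι ℂ E) (T : E →L[ℂ] G)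
    (hT : Summable fun i => ‖T (b i)‖ ^ 2) : IsCompactOperator T := by
  let f : ι → E →L[ℂ] G := fun i => (innerSL ℂ (b i)).smulRight (T (b i))
  have hf : Summable f := by
    refine summable_of_norm_sum_sq_le hT 1 fun t => ?_
    rw [one_mul, ← Real.sqrt_le_sqrt_iff (by positivity), Real.sqrt_sq (by positivity)]
    refine ContinuousLinearMap.opNorm_le_bound _ (by positivity) fun x => ?_
    have h1 : ‖(∑ i ∈ t, f i) x‖ ≤ ∑ i ∈ t, ‖T (b i)‖ * ‖inner ℂ (b i) x‖ := by
      rw [sum_apply]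
      refine (norm_sum_le _ _).trans (Finset.sum_le_sum fun i _ => ?_)
      simp [f, norm_smul, mul_comm]
    refine h1.trans ((Real.sum_mul_le_sqrt_mul_sqrt _ _ _).trans ?_)
    gcongr
    rw [Real.sqrt_le_left (norm_nonneg _)]
    exact b.orthonormal.sum_inner_products_le x
  have hsum : ∑' i, f i = T := by
    ext x
    have h1 := (ContinuousLinearMap.apply ℂ G x).hasSum hf.hasSum
    have h2 := T.hasSum (b.hasSum_repr x)
    refine h1.unique (h2.congr_fun fun i => ?_)
    simp [f, b.repr_apply_apply]
  rw [← hsum]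
  refine isCompactOperator_of_tendsto hf.hasSum (Filter.Eventually.of_forall fun t => ?_)
  change (∑ i ∈ t, f i) ∈ compactOperator (RingHom.id ℂ) E G
  refine sum_mem fun i _ => ?_
  change IsCompactOperator _
  have h : IsCompactOperator (ContinuousLinearMap.toSpanSingleton ℂ (T (b i))) :=
    isCompactOperator_of_locallyCompactSpace_rng _
  have h2 : IsCompactOperator
      (ContinuousLinearMap.toSpanSingleton ℂ (T (b i)) ∘ innerSL ℂ (b i)) := h.comp_clm _
  exact h2

end HilbertSchmidt

/-! ### Traces and eigenbases -/

section Trace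

variable {L : Type*} [NormedAddCommGroup L] [InnerProductSpace ℂ L] [CompleteSpace L]

theorem ofReal_inner_eq_enorm_sqrt_sq {T : L →L[ℂ] L} (hT : 0 ≤ T) (x : L) :
    ENNReal.ofReal (inner ℂ x (T x)).re = ‖CFC.sqrt T x‖ₑ ^ 2 := by
  have hs : IsSelfAdjoint (CFC.sqrt T) := (CFC.sqrt_nonneg T).isSelfAdjoint
  have h : inner ℂ x (T x) = inner ℂ (CFC.sqrt T x) (CFC.sqrt T x) := by
    conv_lhs => rw [← CFC.sqrt_mul_sqrt_self T hT]
    rw [mul_apply_eq_comp, ← ContinuousLinearMap.adjoint_inner_left,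
      ← ContinuousLinearMap.star_eq_adjoint, hs.star_eq]
  rw [h, inner_self_eq_norm_sq_to_K, ← ofReal_norm, ← ENNReal.ofReal_pow (norm_nonneg _)]
  norm_cast

theorem posTrace_eq_tsum {T : L →L[ℂ] L} (hT : 0 ≤ T) {κ : Type*} (v : HilbertBasis κ ℂ L) :
    posTrace T = ∑' k, ENNReal.ofReal (inner ℂ (v k) (T (v k))).re := by
  have hs : IsSelfAdjoint (CFC.sqrt T) := (CFC.sqrt_nonneg T).isSelfAdjoint
  simp only [posTrace, ofReal_inner_eq_enorm_sqrt_sq hT]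
  rw [tsum_enorm_sq_adjoint _ v, ← ContinuousLinearMap.star_eq_adjoint, hs.star_eq]

/-- The trace of `T` is the squared Hilbert–Schmidt norm of `√T`; hence `√T`, and with it `T = √T
√T`, is compact. -/
theorem isCompactOperator_of_posTrace_lt_top {T : L →L[ℂ] L} (hT : 0 ≤ T)
    (h : posTrace T < ⊤) : IsCompactOperator T := by
  obtain ⟨w, b, -⟩ := exists_hilbertBasis ℂ L
  rw [posTrace_eq_tsum hT b] at h
  simp only [ofReal_inner_eq_enorm_sqrt_sq hT] at h
  have h1 : Summable fun i => ‖CFC.sqrt T (b i)‖ ^ 2 := by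
    have := ENNReal.summable_toReal h.ne
    simpa using this
  have h2 := (isCompactOperator_of_summable_norm_sq b _ h1).clm_comp (CFC.sqrt T)
  rw [← ContinuousLinearMap.coe_comp, ← ContinuousLinearMap.mul_def,
    CFC.sqrt_mul_sqrt_self T hT] at h2
  exact h2

/-- Eigenspaces of a compact symmetric operator, the kernel included, are orthogonal with dense
span, so orthonormal bases of all of them combine into one. -/
theorem exists_eigenbasis {L : Type u} [NormedAddCommGroup L] [InnerProductSpace ℂ L]
    [CompleteSpace L] {T : L →L[ℂ] L} (hT : IsCompactOperator T) (hT0 : 0 ≤ T) :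
    ∃ (κ : Type u) (v : HilbertBasis κ ℂ L) (t : κ → ℝ),
      (∀ k, 0 ≤ t k) ∧ ∀ k, T (v k) = (t k : ℂ) • v k := by
  have hpos : T.IsPositive := (ContinuousLinearMap.nonneg_iff_isPositive T).1 hT0
  have hsymm : T.toLinearMap.IsSymmetric := hpos.isSymmetric
  have hcl (μ : ℂ) : CompleteSpace (Module.End.eigenspace T.toLinearMap μ) := by
    refine IsClosed.completeSpace_coe (hs := ?_)
    have : (Module.End.eigenspace T.toLinearMap μ : Set L) = {x | T x = μ • x} := by
      ext x; simp
    rw [this]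
    exact isClosed_eq T.continuous (continuous_const_smul μ)
  choose w b hb using fun μ : ℂ => exists_hilbertBasis ℂ (Module.End.eigenspace T.toLinearMap μ)
  let v : (Σ μ, w μ) → L := fun k => (b k.1 k.2 : L)
  have hv : Orthonormal ℂ v :=
    hsymm.orthogonalFamily_eigenspaces.orthonormal_sigma_orthonormal fun μ => (b μ).orthonormal
  have hspan : (Submodule.span ℂ (Set.range v))ᗮ = ⊥ := by
    rw [eq_bot_iff, ← ContinuousLinearMap.orthogonalComplement_iSup_eigenspaces_eq_bot hT hsymm,
      ← Submodule.orthogonal_closure]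
    refine Submodule.orthogonal_le (iSup_le fun μ x hx => ?_)
    have h := (Submodule.subtypeL _).hasSum ((b μ).hasSum_repr ⟨x, hx⟩)
    refine (Submodule.isClosed_topologicalClosure _).mem_of_tendsto h
      (Filter.Eventually.of_forall fun t => sum_mem fun i _ => ?_)
    rw [map_smul]
    exact Submodule.smul_mem _ _ (Submodule.le_topologicalClosure _
      (Submodule.subset_span ⟨⟨μ, i⟩, rfl⟩))
  refine ⟨_, HilbertBasis.mkOfOrthogonalEqBot hv hspan,
    fun k => (inner ℂ (v k) (T (v k))).re, fun k => ?_, fun k => ?_⟩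
  · exact hpos.re_inner_nonneg_right _
  · rw [HilbertBasis.coe_mkOfOrthogonalEqBot]
    have h1 : T (v k) = k.1 • v k := Module.End.mem_eigenspace_iff.1 (b k.1 k.2).2
    have h2 : inner ℂ (v k) (T (v k)) = k.1 := by
      rw [h1, inner_smul_right, inner_self_eq_norm_sq_to_K, hv.1 k]; simp
    have h3 : ((inner ℂ (v k) (T (v k))).re : ℂ) = inner ℂ (v k) (T (v k)) :=
      (Complex.eq_re_of_ofReal_le (r := 0) (by simpa using hpos.inner_nonneg_right (v k))).symm
    rw [h3, h2, h1]

theorem cfc_apply_of_eigenvector {T : L →L[ℂ] L} (hT : IsSelfAdjoint T) {c : ℝ} {x : L}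
    (hx : T x = (c : ℂ) • x) {f : ℝ → ℝ} (hf : Continuous f) :
    cfc f T x = (f c : ℂ) • x := by
  rcases eq_or_ne x 0 with rfl | hx0
  · simp
  have hc : c ∈ spectrum ℝ T := by
    rw [spectrum.mem_iff]
    intro h
    apply hx0
    obtain ⟨u, hu⟩ := h
    have h0 : (u : L →L[ℂ] L) x = 0 := by
      rw [hu, sub_apply, hx, Algebra.algebraMap_eq_smul_one, smul_apply,
        one_apply_eq_self, Complex.coe_smul, sub_self]
    have h1 : ((↑u⁻¹ : L →L[ℂ] L) * (u : L →L[ℂ] L)) x = 0 := by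
      rw [mul_apply_eq_comp, h0, map_zero]
    simpa using h1
  rw [cfc_apply f T hT hf.continuousOn]
  have key : ∀ g : C(spectrum ℝ T, ℝ), cfcHom hT g x = (g ⟨c, hc⟩ : ℂ) • x := by
    intro g
    -- Stone–Weierstrass: the identity holds for constants and the coordinate, and survives sums,
    -- products and uniform limits.
    induction g using ContinuousMap.induction_on_of_compact with
    | const r =>
      have h : ContinuousMap.const (spectrum ℝ T) r = algebraMap ℝ _ r := rfl
      rw [h, AlgHomClass.commutes, Algebra.algebraMap_eq_smul_one, smul_apply, one_apply_eq_self]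
      rfl
    | id => rw [cfcHom_id, hx]; rfl
    | star_id => rw [map_star, cfcHom_id, hT.star_eq, hx]; rfl
    | add f g hf hg =>
      rw [map_add, add_apply, hf, hg, ← add_smul, ContinuousMap.add_apply, Complex.ofReal_add]
    | mul f g hf hg =>
      rw [map_mul, mul_apply_eq_comp, hg, map_smul, hf, smul_smul, ContinuousMap.mul_apply,
        Complex.ofReal_mul, mul_comm]
    | frequently f hf =>
      have hcl : IsClosed {g : C(spectrum ℝ T, ℝ) | cfcHom hT g x = (g ⟨c, hc⟩ : ℂ) • x} := by
        refine isClosed_eq ?_ ?_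
        · exact (ContinuousLinearMap.apply ℂ L x).continuous.comp (cfcHom_continuous hT)
        · exact (Complex.continuous_ofReal.comp (continuous_eval_const _)).smul
            continuous_const
      exact hcl.mem_of_frequently_of_tendsto hf Filter.tendsto_id
  exact key _

theorem nnrpow_apply_of_eigenvector {T : L →L[ℂ] L} (hT : 0 ≤ T) {c : ℝ} {x : L}
    (hx : T x = (c : ℂ) • x) {p : ℝ≥0} (hp : 0 < p) :
    (T ^ p) x = ((c ^ (p : ℝ) : ℝ) : ℂ) • x := by
  rw [CFC.nnrpow_eq_rpow hp, CFC.rpow_eq_cfc_real hT]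
  exact cfc_apply_of_eigenvector hT.isSelfAdjoint hx (Real.continuous_rpow_const p.2)

theorem posTrace_nnrpow_eq_tsum {T : L →L[ℂ] L} (hT : 0 ≤ T) {κ : Type*} (v : HilbertBasis κ ℂ L)
    {s : κ → ℝ} (hv : ∀ k, T (v k) = (s k : ℂ) • v k) {p : ℝ≥0} (hp : 0 < p) :
    posTrace (T ^ p) = ∑' k, ENNReal.ofReal (s k ^ (p : ℝ)) := by
  have hTp : 0 ≤ T ^ p := CFC.nnrpow_nonneg
  rw [posTrace_eq_tsum hTp v]
  refine tsum_congr fun k => ?_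
  rw [nnrpow_apply_of_eigenvector hT (hv k) hp, inner_smul_right,
    inner_self_eq_norm_sq_to_K, v.orthonormal.1 k]
  simp

/-- The eigenvalues of `|B|` are the singular values of `B`. -/
theorem MemSchatten.exists_eigenbasis_abs {L : Type u} [NormedAddCommGroup L]
    [InnerProductSpace ℂ L] [CompleteSpace L] {r : ℝ≥0∞} (hr0 : r ≠ 0) (hr : r ≠ ⊤)
    {B : L →L[ℂ] L} (hB : MemSchatten r B) :
    ∃ (κ : Type u) (v : HilbertBasis κ ℂ L) (s : κ → ℝ),
      (∀ k, 0 ≤ s k) ∧ ∀ k, CFC.abs B (v k) = (s k : ℂ) • v k := by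
  have hr' : 0 < r.toReal := ENNReal.toReal_pos hr0 hr
  have hrn : 0 < r.toNNReal := ENNReal.toNNReal_pos hr0 hr
  have hT0 : 0 ≤ CFC.abs B ^ r.toNNReal := CFC.nnrpow_nonneg
  have htr : posTrace (CFC.abs B ^ r.toNNReal) < ⊤ := by
    have h := hB
    rw [MemSchatten, schattenENorm, if_neg hr] at h
    by_contra hcon
    rw [not_lt_top_iff.1 hcon, ENNReal.top_rpow_of_pos (by positivity)] at h
    exact h.ne rfl
  -- Finite trace gives compactness of `|B|^r`, so that operator is diagonalised and the eigenvalues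
  -- of `|B|` are recovered as `r`-th roots.
  obtain ⟨κ, v, t, ht, hv⟩ := exists_eigenbasis
    (isCompactOperator_of_posTrace_lt_top hT0 htr) hT0
  refine ⟨κ, v, fun k => t k ^ ((r.toNNReal⁻¹ : ℝ≥0) : ℝ), fun k => Real.rpow_nonneg (ht k) _,
    fun k => ?_⟩
  have h := nnrpow_apply_of_eigenvector hT0 (hv k) (inv_pos.2 hrn)
  rwa [CFC.nnrpow_nnrpow_inv _ hrn.ne' (CFC.abs_nonneg B)] at h

theorem schattenENorm_eq_tsum {r : ℝ≥0∞} (hr0 : r ≠ 0) (hr : r ≠ ⊤) {B : L →L[ℂ] L} {κ : Type*}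
    (v : HilbertBasis κ ℂ L) {s : κ → ℝ} (hv : ∀ k, CFC.abs B (v k) = (s k : ℂ) • v k) :
    schattenENorm r B = (∑' k, ENNReal.ofReal (s k ^ r.toReal)) ^ (1 / r.toReal) := by
  rw [schattenENorm, if_neg hr,
    posTrace_nnrpow_eq_tsum (CFC.abs_nonneg B) v hv (ENNReal.toNNReal_pos hr0 hr)]
  rfl

theorem MemSchatten.summable_rpow {r : ℝ≥0∞} (hr0 : r ≠ 0) (hr : r ≠ ⊤) {B : L →L[ℂ] L}
    (hB : MemSchatten r B) {κ : Type*} (v : HilbertBasis κ ℂ L) {s : κ → ℝ} (hs : ∀ k, 0 ≤ s k)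
    (hv : ∀ k, CFC.abs B (v k) = (s k : ℂ) • v k) :
    Summable (fun k => s k ^ r.toReal) ∧
      schattenNorm r B = (∑' k, s k ^ r.toReal) ^ (1 / r.toReal) := by
  have hr' : 0 < r.toReal := ENNReal.toReal_pos hr0 hr
  have hB' := hB
  rw [MemSchatten, schattenENorm_eq_tsum hr0 hr v hv] at hB'
  have hfin : ∑' k, ENNReal.ofReal (s k ^ r.toReal) ≠ ⊤ := by
    intro h
    rw [h, ENNReal.top_rpow_of_pos (by positivity)] at hB'
    exact hB'.ne rfl
  have hsum : Summable (fun k => s k ^ r.toReal) := by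
    refine (ENNReal.summable_toReal hfin).congr fun k => ?_
    rw [ENNReal.toReal_ofReal (Real.rpow_nonneg (hs k) _)]
  refine ⟨hsum, ?_⟩
  rw [schattenNorm, schattenENorm_eq_tsum hr0 hr v hv,
    ← ENNReal.ofReal_tsum_of_nonneg (fun k => Real.rpow_nonneg (hs k) _) hsum,
    ← ENNReal.toReal_rpow, ENNReal.toReal_ofReal (tsum_nonneg fun k => Real.rpow_nonneg (hs k) _)]

/-- Summability of `s_k^q` leaves only finitely many `s_k > 1`; for the others `s_k^r ≤ s_k^q`. -/
theorem MemSchatten.mono {q r : ℝ≥0∞} (hq0 : q ≠ 0) (hqr : q ≤ r) (hr : r ≠ ⊤) {B : L →L[ℂ] L}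
    (hB : MemSchatten q B) : MemSchatten r B := by
  have hq : q ≠ ⊤ := ne_top_of_le_ne_top hr hqr
  have hr0 : r ≠ 0 := (hq0.bot_lt.trans_le hqr).ne'
  obtain ⟨κ, v, s, hs, hv⟩ := hB.exists_eigenbasis_abs hq0 hq
  have hsum := (hB.summable_rpow hq0 hq v hs hv).1
  have hle : q.toReal ≤ r.toReal := ENNReal.toReal_mono hr hqr
  have hsum' : Summable fun k => s k ^ r.toReal := by
    refine Summable.of_norm_bounded_eventually hsum ?_
    have h1 := hsum.tendsto_cofinite_zero.eventually_le_const zero_lt_one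
    filter_upwards [h1] with k hk
    rw [Real.norm_of_nonneg (Real.rpow_nonneg (hs k) _)]
    have hk1 : s k ≤ 1 := by
      by_contra! hcon
      exact absurd hk (not_le.2 (Real.one_lt_rpow hcon (ENNReal.toReal_pos hq0 hq)))
    exact Real.rpow_le_rpow_of_exponent_ge' (hs k) hk1 ENNReal.toReal_nonneg hle
  rw [MemSchatten, schattenENorm_eq_tsum hr0 hr v hv,
    ← ENNReal.ofReal_tsum_of_nonneg (fun k => Real.rpow_nonneg (hs k) _) hsum']
  exact ENNReal.rpow_lt_top_of_nonneg (by positivity) ENNReal.ofReal_ne_top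

end Trace

/-! ### The bounded extensions of the creation and annihilation operators -/

namespace CARRep

variable {L : Type*} [NormedAddCommGroup L] [InnerProductSpace ℂ L] {J : Conjugation L}
  {F : Type*} [NormedAddCommGroup F] [InnerProductSpace ℂ F] (R : CARRep J F)

theorem eq_of_eqOn_domain {E : Type*} [TopologicalSpace E] [T2Space E] {S T : F → E}
    (hS : Continuous S) (hT : Continuous T) (h : ∀ Φ : R.D, S Φ = T Φ) (x : F) : S x = T x :=
  congrFun (R.dense.denseRange_val.equalizer hS hT (funext h)) x

variable [CompleteSpace F]

theorem ann_add (f g : L) (x : F) : R.ann (f + g) x = R.ann f x + R.ann g x := by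
  revert x
  refine R.eq_of_eqOn_domain (by fun_prop) (by fun_prop) fun Φ => ?_
  simp [ann_coe]

theorem ann_smul (c : ℂ) (f : L) (x : F) : R.ann (c • f) x = c • R.ann f x := by
  revert x
  refine R.eq_of_eqOn_domain (by fun_prop) (by fun_prop) fun Φ => ?_
  simp [ann_coe]

theorem cre_add (f g : L) (x : F) : R.cre (f + g) x = R.cre f x + R.cre g x := by
  revert x
  refine R.eq_of_eqOn_domain (by fun_prop) (by fun_prop) fun Φ => ?_
  simp [cre_coe]

theorem cre_smul (c : ℂ) (f : L) (x : F) : R.cre (c • f) x = c • R.cre f x := by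
  revert x
  refine R.eq_of_eqOn_domain (by fun_prop) (by fun_prop) fun Φ => ?_
  simp [cre_coe]

theorem norm_ann_apply_le (f : L) (x : F) : ‖R.ann f x‖ ≤ ‖f‖ * ‖x‖ := by
  refine R.dense.induction (P := fun x => ‖R.ann f x‖ ≤ ‖f‖ * ‖x‖) (fun Φ hΦ => ?_)
    (isClosed_le (by fun_prop) (by fun_prop)) x
  rw [R.ann_coe f ⟨Φ, hΦ⟩]
  exact R.norm_a_le f _

theorem norm_cre_apply_le (f : L) (x : F) : ‖R.cre f x‖ ≤ ‖f‖ * ‖x‖ := by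
  refine R.dense.induction (P := fun x => ‖R.cre f x‖ ≤ ‖f‖ * ‖x‖) (fun Φ hΦ => ?_)
    (isClosed_le (by fun_prop) (by fun_prop)) x
  rw [R.cre_coe f ⟨Φ, hΦ⟩]
  exact R.norm_aDag_le f _

/-- The map `f ↦ a(f) x` as a bounded operator. -/
noncomputable def annCLM (x : F) : L →L[ℂ] F :=
  LinearMap.mkContinuous
    { toFun := fun f => R.ann f x
      map_add' := fun f g => R.ann_add f g x
      map_smul' := fun c f => R.ann_smul c f x } ‖x‖
    fun f => (R.norm_ann_apply_le f x).trans_eq (mul_comm _ _)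

@[simp] theorem annCLM_apply (x : F) (f : L) : R.annCLM x f = R.ann f x := rfl

/-- The map `f ↦ a†(f) x` as a bounded operator. -/
noncomputable def creCLM (x : F) : L →L[ℂ] F :=
  LinearMap.mkContinuous
    { toFun := fun f => R.cre f x
      map_add' := fun f g => R.cre_add f g x
      map_smul' := fun c f => R.cre_smul c f x } ‖x‖
    fun f => (R.norm_cre_apply_le f x).trans_eq (mul_comm _ _)

theorem cre_cre (f g : L) (x : F) : R.cre f (R.cre g x) = -R.cre g (R.cre f x) := by
  revert x
  refine R.eq_of_eqOn_domain (by fun_prop) (by fun_prop) fun Φ => ?_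
  have h := congrArg (Subtype.val) (R.car_aDag f g Φ)
  simp only [cre_coe]
  exact eq_neg_of_add_eq_zero_left h

theorem ann_cre (f g : L) (x : F) :
    R.ann f (R.cre g x) = inner ℂ (J.toMap f) g • x - R.cre g (R.ann f x) := by
  revert x
  refine R.eq_of_eqOn_domain (by fun_prop) (by fun_prop) fun Φ => ?_
  have h := congrArg (Subtype.val) (R.car_mixed f g Φ)
  simp only [cre_coe, ann_coe]
  exact eq_sub_of_add_eq h

theorem inner_ann_left (f : L) (x y : F) :
    inner ℂ (R.ann f x) y = inner ℂ x (R.cre (J.toMap f) y) := by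
  refine R.eq_of_eqOn_domain (S := fun x => inner ℂ (R.ann f x) y)
    (T := fun x => inner ℂ x (R.cre (J.toMap f) y)) (by fun_prop) (by fun_prop) (fun Φ => ?_) x
  refine R.eq_of_eqOn_domain (S := fun y => inner ℂ (R.ann f Φ) y)
    (T := fun y => inner ℂ (Φ : F) (R.cre (J.toMap f) y)) (by fun_prop) (by fun_prop)
    (fun Ψ => ?_) y
  simp only [cre_coe, ann_coe]
  exact R.unitarity f Φ Ψ

theorem inner_cre_right (f : L) (x y : F) :
    inner ℂ x (R.cre f y) = inner ℂ (R.ann (J.toMap f) x) y := by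
  rw [inner_ann_left, J.involutive]

theorem inner_cre_left (f : L) (x y : F) :
    inner ℂ (R.cre f x) y = inner ℂ x (R.ann (J.toMap f) y) := by
  rw [← inner_conj_symm, inner_cre_right, inner_conj_symm]

/-- The product `a†(f) a(g)` commutes with `a†(h)` up to the term `(ḡ, h) a†(f)`. -/
theorem cre_ann_cre (f g h : L) (x : F) :
    R.cre f (R.ann g (R.cre h x))
      = R.cre h (R.cre f (R.ann g x)) + inner ℂ (J.toMap g) h • R.cre f x := by
  rw [ann_cre, map_sub, map_smul, R.cre_cre f h]
  abel

theorem norm_inner_sum_cre_ann_le {κ : Type*} (f g : κ → L) (t : Finset κ) (x y : F) :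
    ‖inner ℂ y (∑ k ∈ t, R.cre (f k) (R.ann (g k) x))‖
      ≤ ∑ k ∈ t, ‖R.ann (J.toMap (f k)) y‖ * ‖R.ann (g k) x‖ := by
  rw [inner_sum]
  refine (norm_sum_le _ _).trans (Finset.sum_le_sum fun k _ => ?_)
  rw [inner_cre_right]
  exact norm_inner_le_norm _ _

end CARRep

/-! ### Orthonormal families and conjugations -/

theorem Orthonormal.exists_hilbertBasis_apply_eq {E κ : Type*} [NormedAddCommGroup E]
    [InnerProductSpace ℂ E] [CompleteSpace E] {v : κ → E} (hv : Orthonormal ℂ v) :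
    ∃ (w : Set E) (b : HilbertBasis w ℂ E) (i : κ ↪ w), ∀ k, b (i k) = v k := by
  obtain ⟨w, b, hw, hb⟩ := hv.toSubtypeRange.exists_hilbertBasis_extension
  refine ⟨w, b, ⟨fun k => ⟨v k, hw ⟨k, rfl⟩⟩, fun k l h => ?_⟩, fun k => ?_⟩
  · exact hv.linearIndependent.injective (Subtype.ext_iff.1 h)
  · rw [hb]; rfl

/-- Passing to adjoints turns composition on the right into `C* A*`, where the bound by `‖C‖` acts
vector by vector. -/
theorem tsum_enorm_comp_sq_le {E G ι : Type*} [NormedAddCommGroup E] [InnerProductSpace ℂ E]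
    [CompleteSpace E] [NormedAddCommGroup G] [InnerProductSpace ℂ G] [CompleteSpace G]
    (b : HilbertBasis ι ℂ E) (A : E →L[ℂ] G) (C : E →L[ℂ] E) :
    ∑' i, ‖A (C (b i))‖ₑ ^ 2 ≤ ‖C‖ₑ ^ 2 * ∑' i, ‖A (b i)‖ₑ ^ 2 := by
  obtain ⟨w, x, -⟩ := exists_hilbertBasis ℂ G
  have h := tsum_enorm_sq_adjoint b x (A ∘L C)
  simp only [ContinuousLinearMap.comp_apply] at h
  rw [h, tsum_enorm_sq_adjoint b x A, ← ENNReal.tsum_mul_left]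
  refine ENNReal.tsum_le_tsum fun k => ?_
  rw [ContinuousLinearMap.adjoint_comp, ContinuousLinearMap.comp_apply, ← mul_pow]
  gcongr
  have h2 := (ContinuousLinearMap.adjoint C).le_opENorm (ContinuousLinearMap.adjoint A (x k))
  rwa [LinearIsometryEquiv.enorm_map] at h2

namespace Conjugation

variable {L : Type*} [NormedAddCommGroup L] [InnerProductSpace ℂ L] (J : Conjugation L)

/-- Polarization: the conjugation keeps norms and exchanges the two terms containing `i`. -/
theorem inner_map_map (f g : L) :
    inner ℂ (J.toMap f) (J.toMap g) = starRingEnd ℂ (inner ℂ f g) := by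
  have h (x : L) : ‖J.toMap x‖ = ‖x‖ := J.toMap.norm_map x
  have h1 : J.toMap f + J.toMap g = J.toMap (f + g) := by simp
  have h2 : J.toMap f - J.toMap g = J.toMap (f - g) := by simp
  have h3 : J.toMap f - (RCLike.I : ℂ) • J.toMap g = J.toMap (f + (RCLike.I : ℂ) • g) := by
    simp [map_smulₛₗ, sub_eq_add_neg]
  have h4 : J.toMap f + (RCLike.I : ℂ) • J.toMap g = J.toMap (f - (RCLike.I : ℂ) • g) := by
    simp [map_smulₛₗ, sub_eq_add_neg]
  rw [inner_eq_sum_norm_sq_div_four, inner_eq_sum_norm_sq_div_four, h1, h2, h3, h4, h, h, h, h]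
  have h5 : starRingEnd ℂ 4 = 4 := Complex.conj_ofNat 4
  simp [h5]
  ring

theorem orthonormal_comp {κ : Type*} {v : κ → L} (hv : Orthonormal ℂ v) :
    Orthonormal ℂ fun k => J.toMap (v k) := by
  refine ⟨fun k => (J.toMap.norm_map _).trans (hv.1 k), fun k l hkl => ?_⟩
  change inner ℂ (J.toMap (v k)) (J.toMap (v l)) = 0
  rw [J.inner_map_map, hv.2 hkl, map_zero]

/-- The operator `f ↦ conj (B (conj f))`. -/
noncomputable def conjOp (B : L →L[ℂ] L) : L →L[ℂ] L :=
  LinearMap.mkContinuous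
    { toFun := fun f => J.toMap (B (J.toMap f))
      map_add' := fun f g => by simp
      map_smul' := fun c f => by simp [map_smulₛₗ] } ‖B‖
    fun f => by
      simpa using B.le_opNorm (J.toMap f)

theorem conjOp_apply (B : L →L[ℂ] L) (f : L) : J.conjOp B f = J.toMap (B (J.toMap f)) := rfl

theorem norm_conjOp_le (B : L →L[ℂ] L) : ‖J.conjOp B‖ ≤ ‖B‖ :=
  LinearMap.mkContinuous_norm_le _ (norm_nonneg _) _

end Conjugation

/-! ### The `n`-particle spaces -/

namespace FockRep

variable {L : Type*} [NormedAddCommGroup L] [InnerProductSpace ℂ L] {J : Conjugation L}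
  {F : Type*} [NormedAddCommGroup F] [InnerProductSpace ℂ F] [CompleteSpace F] (R : FockRep J F)

/-- The algebraic span of the vectors `a†(f_n) ⋯ a†(f_1) Ω`. -/
def algParticleSpace (n : ℕ) : Submodule ℂ F :=
  Submodule.span ℂ (R.createFrom R.Ω '' {l : List L | l.length = n})

theorem algParticleSpace_le (n : ℕ) : R.algParticleSpace n ≤ R.particleSpace n :=
  Submodule.le_topologicalClosure _

theorem isClosed_particleSpace (n : ℕ) : IsClosed (R.particleSpace n : Set F) :=
  Submodule.isClosed_topologicalClosure _

theorem createFrom_mem (l : List L) : R.createFrom R.Ω l ∈ R.algParticleSpace l.length :=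
  Submodule.subset_span ⟨l, rfl, rfl⟩

theorem createFrom_cons (f : L) (l : List L) :
    R.createFrom R.Ω (f :: l) = R.cre f (R.createFrom R.Ω l) := rfl

theorem particleSpace_induction {n : ℕ} {p : F → Prop} (hp : IsClosed {x | p x})
    (h : ∀ x ∈ R.algParticleSpace n, p x) {x : F} (hx : x ∈ R.particleSpace n) : p x :=
  closure_minimal (s := (R.algParticleSpace n : Set F)) h hp hx

theorem cre_mem {n : ℕ} (f : L) {x : F} (hx : x ∈ R.algParticleSpace n) :
    R.cre f x ∈ R.algParticleSpace (n + 1) := by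
  induction hx using Submodule.span_induction with
  | mem x h =>
    obtain ⟨l, rfl, rfl⟩ := h
    exact R.createFrom_mem (f :: l)
  | zero => simp
  | add x y _ _ hx hy => rw [map_add]; exact add_mem hx hy
  | smul c x _ hx => rw [map_smul]; exact Submodule.smul_mem _ _ hx

/-- Induction on the number of creators: `a†(f) a(g)` moves past each of them at the cost of
replacing one by `a†(f)`, and it kills the vacuum. -/
theorem cre_ann_mem {n : ℕ} (f g : L) {x : F} (hx : x ∈ R.particleSpace n) :
    R.cre f (R.ann g x) ∈ R.particleSpace n := by
  refine R.particleSpace_induction (p := fun x => R.cre f (R.ann g x) ∈ R.particleSpace n)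
    ((R.isClosed_particleSpace n).preimage (by fun_prop)) (fun x hx => ?_) hx
  apply R.algParticleSpace_le
  induction hx using Submodule.span_induction with
  | mem x h =>
    obtain ⟨l, rfl, rfl⟩ := h
    clear hx
    induction l with
    | nil =>
      have h : R.ann g (R.createFrom R.Ω []) = 0 := R.ann_vacuum g
      rw [h, map_zero]
      exact zero_mem _
    | cons h l ih =>
      rw [createFrom_cons, CARRep.cre_ann_cre]
      exact add_mem (R.cre_mem h ih) (Submodule.smul_mem _ _ (R.cre_mem f (R.createFrom_mem l)))
  | zero => simp
  | add x y _ _ hx hy => simp only [map_add]; exact add_mem hx hy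
  | smul c x _ hx => simp only [map_smul]; exact Submodule.smul_mem _ _ hx

/-- The value of `dΓ(B)` on `a†(f_n) ⋯ a†(f_1) Ω`, by the Leibniz rule. -/
noncomputable def dGammaCreateFrom (B : L →L[ℂ] L) : List L → F
  | [] => 0
  | f :: l => R.cre f (dGammaCreateFrom B l) + R.cre (B f) (R.createFrom R.Ω l)

theorem dGammaCreateFrom_id (l : List L) :
    R.dGammaCreateFrom (ContinuousLinearMap.id ℂ L) l = (l.length : ℂ) • R.createFrom R.Ω l := by
  induction l with
  | nil => simp [dGammaCreateFrom]
  | cons f l ih =>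
    rw [dGammaCreateFrom, ih, createFrom_cons, map_smul]
    simp [add_smul]

theorem dGammaTerm_add {ι : Type*} (e : ι → L) (B : L →L[ℂ] L) (x y : F) :
    R.dGammaTerm e B (x + y) = R.dGammaTerm e B x + R.dGammaTerm e B y := by
  funext j; simp [dGammaTerm]

theorem dGammaTerm_smul {ι : Type*} (e : ι → L) (B : L →L[ℂ] L) (c : ℂ) (x : F) :
    R.dGammaTerm e B (c • x) = c • R.dGammaTerm e B x := by
  funext j; simp [dGammaTerm]

theorem dGammaTerm_zero {ι : Type*} (e : ι → L) (B : L →L[ℂ] L) :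
    R.dGammaTerm e B 0 = 0 := by
  funext j; simp [dGammaTerm]

/-- Moving past `a†(f)` produces the extra series `∑ ⟪e_j, f⟫ a†(B e_j)`, which sums to `a†(B f)` by
continuity. The resulting value does not involve the basis. -/
theorem hasSum_dGammaTerm_createFrom {ι : Type*} (e : HilbertBasis ι ℂ L) (B : L →L[ℂ] L)
    (l : List L) :
    HasSum (R.dGammaTerm e B (R.createFrom R.Ω l)) (R.dGammaCreateFrom B l) := by
  induction l with
  | nil =>
    refine hasSum_zero.congr_fun fun j => ?_
    have h : R.ann (J.toMap (e j)) (R.createFrom R.Ω []) = 0 := R.ann_vacuum _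
    rw [dGammaTerm, h, map_zero]
  | cons f l ih =>
    have h1 := (R.cre f).hasSum ih
    have h2 := (R.creCLM (R.createFrom R.Ω l) ∘L B).hasSum (e.hasSum_repr f)
    refine (h1.add h2).congr_fun fun j => ?_
    rw [dGammaTerm, createFrom_cons, CARRep.cre_ann_cre, J.involutive, dGammaTerm,
      e.repr_apply_apply, map_smul]
    rfl

/-- On the algebraic `n`-particle space, `dΓ(B)` does not depend on the orthonormal basis. -/
theorem exists_hasSum_dGammaTerm {ι κ : Type*} (e : HilbertBasis ι ℂ L) (v : HilbertBasis κ ℂ L)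
    (B : L →L[ℂ] L) {n : ℕ} {x : F} (hx : x ∈ R.algParticleSpace n) :
    ∃ y, HasSum (R.dGammaTerm e B x) y ∧ HasSum (R.dGammaTerm v B x) y := by
  induction hx using Submodule.span_induction with
  | mem x h =>
    obtain ⟨l, rfl, rfl⟩ := h
    exact ⟨_, R.hasSum_dGammaTerm_createFrom e B l, R.hasSum_dGammaTerm_createFrom v B l⟩
  | zero =>
    refine ⟨0, ?_, ?_⟩ <;> rw [dGammaTerm_zero] <;> exact hasSum_zero
  | add x y _ _ hx hy =>
    obtain ⟨x', h1, h2⟩ := hx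
    obtain ⟨y', h3, h4⟩ := hy
    refine ⟨x' + y', ?_, ?_⟩ <;> rw [dGammaTerm_add]
    exacts [h1.add h3, h2.add h4]
  | smul c x _ hx =>
    obtain ⟨x', h1, h2⟩ := hx
    refine ⟨c • x', ?_, ?_⟩ <;> rw [dGammaTerm_smul]
    exacts [h1.const_smul c, h2.const_smul c]

theorem hasSum_number_of_mem_algParticleSpace {ι : Type*} (e : HilbertBasis ι ℂ L) {n : ℕ} {x : F}
    (hx : x ∈ R.algParticleSpace n) :
    HasSum (R.dGammaTerm e (ContinuousLinearMap.id ℂ L) x) ((n : ℂ) • x) := by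
  induction hx using Submodule.span_induction with
  | mem x h =>
    obtain ⟨l, rfl, rfl⟩ := h
    rw [← dGammaCreateFrom_id]
    exact R.hasSum_dGammaTerm_createFrom e _ l
  | zero => rw [dGammaTerm_zero, smul_zero]; exact hasSum_zero
  | add x y _ _ hx hy => rw [dGammaTerm_add, smul_add]; exact hx.add hy
  | smul c x _ hx => rw [dGammaTerm_smul, smul_comm]; exact hx.const_smul c

/-- On the algebraic span the full series is `⟪x, N x⟫ = n‖x‖²`. The statement keeps finite partial
sums because they are continuous in `x` and so pass to the closure. -/
theorem sum_norm_ann_sq_le_of_basis {ι : Type*} (e : HilbertBasis ι ℂ L) {n : ℕ} {x : F}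
    (hx : x ∈ R.particleSpace n) (t : Finset ι) :
    ∑ j ∈ t, ‖R.ann (J.toMap (e j)) x‖ ^ 2 ≤ n * ‖x‖ ^ 2 := by
  refine R.particleSpace_induction
    (p := fun x => ∑ j ∈ t, ‖R.ann (J.toMap (e j)) x‖ ^ 2 ≤ n * ‖x‖ ^ 2)
    (isClosed_le (by fun_prop) (by fun_prop)) (fun x hx => ?_) hx
  have h := Complex.reCLM.hasSum ((innerSL ℂ x).hasSum
    (R.hasSum_number_of_mem_algParticleSpace e hx))
  have h1 : HasSum (fun j => ‖R.ann (J.toMap (e j)) x‖ ^ 2) (n * ‖x‖ ^ 2) := by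
    convert! h using 1
    · funext j
      rw [innerSL_apply_apply, dGammaTerm, ContinuousLinearMap.id_apply, CARRep.inner_cre_right,
        inner_self_eq_norm_sq_to_K]
      norm_cast
    · rw [innerSL_apply_apply, inner_smul_right, inner_self_eq_norm_sq_to_K]
      simp [← Complex.ofReal_pow]
  exact sum_le_hasSum t (fun j _ => by positivity) h1

variable [CompleteSpace L]

theorem sum_norm_ann_sq_le {κ : Type*} {v : κ → L} (hv : Orthonormal ℂ v) {n : ℕ} {x : F}
    (hx : x ∈ R.particleSpace n) (t : Finset κ) :
    ∑ j ∈ t, ‖R.ann (J.toMap (v j)) x‖ ^ 2 ≤ n * ‖x‖ ^ 2 := by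
  obtain ⟨w, b, i, hb⟩ := hv.exists_hilbertBasis_apply_eq
  have h := R.sum_norm_ann_sq_le_of_basis b hx (t.map i)
  simpa only [Finset.sum_map, hb] using h

/-- The map `f ↦ a(f) x` is Hilbert–Schmidt with squared norm at most `n‖x‖²`; precomposing it with
the conjugate of `B` costs a factor `‖B‖²`. -/
theorem sum_norm_ann_op_sq_le {κ : Type*} {v : κ → L} (hv : Orthonormal ℂ v) (B : L →L[ℂ] L)
    {n : ℕ} {x : F} (hx : x ∈ R.particleSpace n) (t : Finset κ) :
    ∑ j ∈ t, ‖R.ann (J.toMap (B (v j))) x‖ ^ 2 ≤ n * ‖B‖ ^ 2 * ‖x‖ ^ 2 := by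
  -- The conjugated family is extended, since `conj (B v_j)` is the conjugate operator applied to
  -- `conj v_j`.
  obtain ⟨w, b, i, hb⟩ := (J.orthonormal_comp hv).exists_hilbertBasis_apply_eq
  have h1 : ∑' j, ‖R.annCLM x (b j)‖ₑ ^ 2 ≤ ENNReal.ofReal (n * ‖x‖ ^ 2) := by
    rw [ENNReal.tsum_eq_iSup_sum]
    refine iSup_le fun s => ?_
    have h := R.sum_norm_ann_sq_le (J.orthonormal_comp b.orthonormal) hx s
    simp only [J.involutive] at h
    refine le_trans (le_of_eq ?_) (ENNReal.ofReal_le_ofReal h)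
    rw [ENNReal.ofReal_sum_of_nonneg fun _ _ => by positivity]
    simp only [ENNReal.ofReal_pow (norm_nonneg _), ofReal_norm, CARRep.annCLM_apply]
  have h2 := tsum_enorm_comp_sq_le b (R.annCLM x) (J.conjOp B)
  have h3 : ‖J.conjOp B‖ₑ ^ 2 ≤ ENNReal.ofReal (‖B‖ ^ 2) := by
    rw [← ofReal_norm, ← ENNReal.ofReal_pow (norm_nonneg _)]
    exact ENNReal.ofReal_le_ofReal (pow_le_pow_left₀ (norm_nonneg _) (J.norm_conjOp_le B) 2)
  have h4 := (ENNReal.sum_le_tsum (t.map i)).trans (h2.trans (mul_le_mul' h3 h1))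
  rw [← ENNReal.ofReal_mul (by positivity)] at h4
  simp only [Finset.sum_map, hb, J.conjOp_apply, J.involutive, CARRep.annCLM_apply,
    ← ofReal_norm, ← ENNReal.ofReal_pow (norm_nonneg _)] at h4
  rw [← ENNReal.ofReal_sum_of_nonneg (fun _ _ => by positivity),
    ENNReal.ofReal_le_ofReal_iff (by positivity)] at h4
  linarith

end FockRep

/-! ### Convergence and first bounds for the second quantization -/

namespace FockRep

variable {L : Type*} [NormedAddCommGroup L] [InnerProductSpace ℂ L] {J : Conjugation L}
  {F : Type*} [NormedAddCommGroup F] [InnerProductSpace ℂ F] [CompleteSpace F] (R : FockRep J F)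

/-- The sum is tested against itself, and it stays in the `n`-particle space; hence only `y` with
the same particle number are needed, where the number bounds apply. -/
theorem norm_sum_cre_ann_le_of_inner_le {κ : Type*} (f g : κ → L) {n : ℕ} {x : F}
    (hx : x ∈ R.particleSpace n) (t : Finset κ) {K : ℝ} (hK : 0 ≤ K)
    (h : ∀ y ∈ R.particleSpace n, ∑ k ∈ t, ‖R.ann (J.toMap (f k)) y‖ * ‖R.ann (g k) x‖ ≤ K * ‖y‖) :
    ‖∑ k ∈ t, R.cre (f k) (R.ann (g k) x)‖ ≤ K := by
  set y := ∑ k ∈ t, R.cre (f k) (R.ann (g k) x) with hy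
  have hmem : y ∈ R.particleSpace n := sum_mem fun k _ => R.cre_ann_mem _ _ hx
  have h1 := (R.norm_inner_sum_cre_ann_le f g t x y).trans (h y hmem)
  rw [← hy, inner_self_eq_norm_sq_to_K] at h1
  rcases (norm_nonneg y).eq_or_lt with h0 | h0
  · rwa [← h0]
  · refine le_of_mul_le_mul_right ?_ h0
    simpa [sq] using h1

theorem norm_sum_cre_ann_sq_le {κ : Type*} (f g : κ → L) {n : ℕ} {x : F}
    (hx : x ∈ R.particleSpace n) (t : Finset κ) {K : ℝ} (hK : 0 ≤ K)
    (hf : ∀ y ∈ R.particleSpace n, ∑ k ∈ t, ‖R.ann (J.toMap (f k)) y‖ ^ 2 ≤ K * ‖y‖ ^ 2) :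
    ‖∑ k ∈ t, R.cre (f k) (R.ann (g k) x)‖ ^ 2 ≤ K * ∑ k ∈ t, ‖R.ann (g k) x‖ ^ 2 := by
  have h : ‖∑ k ∈ t, R.cre (f k) (R.ann (g k) x)‖ ≤ √(K * ∑ k ∈ t, ‖R.ann (g k) x‖ ^ 2) := by
    refine R.norm_sum_cre_ann_le_of_inner_le f g hx t (Real.sqrt_nonneg _) fun y hy => ?_
    refine (Real.sum_mul_le_sqrt_mul_sqrt _ _ _).trans ?_
    calc _ ≤ √(K * ‖y‖ ^ 2) * √(∑ k ∈ t, ‖R.ann (g k) x‖ ^ 2) := by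
          gcongr
          exact hf y hy
      _ = _ := by
          rw [Real.sqrt_mul hK, Real.sqrt_mul hK, Real.sqrt_sq (norm_nonneg y)]
          ring
  exact (Real.le_sqrt (norm_nonneg _) (by positivity)).1 h

theorem summable_cre_ann {κ : Type*} (f g : κ → L) {n : ℕ} {x : F}
    (hx : x ∈ R.particleSpace n) {K M : ℝ} (hK : 0 ≤ K)
    (hf : ∀ y ∈ R.particleSpace n, ∀ t : Finset κ,
      ∑ k ∈ t, ‖R.ann (J.toMap (f k)) y‖ ^ 2 ≤ K * ‖y‖ ^ 2)
    (hg : ∀ t : Finset κ, ∑ k ∈ t, ‖R.ann (g k) x‖ ^ 2 ≤ M) :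
    Summable fun k => R.cre (f k) (R.ann (g k) x) :=
  summable_of_norm_sum_sq_le (summable_of_sum_le (fun _ => by positivity) hg) K fun t =>
    R.norm_sum_cre_ann_sq_le f g hx t hK fun y hy => hf y hy t

theorem mem_finiteParticle {n : ℕ} {x : F} (hx : x ∈ R.particleSpace n) : x ∈ R.finiteParticle :=
  Submodule.mem_iSup_of_mem n hx

theorem exists_sum_of_mem_finiteParticle {x : F} (hx : x ∈ R.finiteParticle) :
    ∃ (t : Finset ℕ) (c : ℕ → F), (∀ n, c n ∈ R.particleSpace n) ∧ ∑ n ∈ t, c n = x := by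
  obtain ⟨c, hc, rfl⟩ := (Submodule.mem_iSup_iff_exists_finsupp _ _).1 hx
  exact ⟨c.support, c, hc, rfl⟩

theorem dense_finiteParticle : Dense (R.finiteParticle : Set F) := by
  have h : Dense (Submodule.span ℂ (Set.range (R.createFrom R.Ω)) : Set F) :=
    Submodule.dense_iff_topologicalClosure_eq_top.2 R.cyclic
  refine h.mono (Submodule.span_le.2 ?_)
  rintro _ ⟨l, rfl⟩
  exact R.mem_finiteParticle (R.algParticleSpace_le _ (R.createFrom_mem l))

variable [CompleteSpace L] {ι : Type*} (e : HilbertBasis ι ℂ L) (B : L →L[ℂ] L)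

theorem norm_sum_dGammaTerm_le {n : ℕ} {x : F} (hx : x ∈ R.particleSpace n) (t : Finset ι) :
    ‖∑ j ∈ t, R.dGammaTerm e B x j‖ ≤ n * ‖B‖ * ‖x‖ := by
  refine abs_le_of_sq_le_sq' ?_ (by positivity) |>.2
  have h := R.norm_sum_cre_ann_sq_le (fun j => B (e j)) (fun j => J.toMap (e j)) hx t
    (by positivity) fun y hy => R.sum_norm_ann_op_sq_le e.orthonormal B hy t
  refine h.trans ?_
  calc _ ≤ n * ‖B‖ ^ 2 * (n * ‖x‖ ^ 2) := by
        gcongr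
        exact R.sum_norm_ann_sq_le e.orthonormal hx t
    _ = _ := by ring

theorem summable_dGammaTerm_of_mem_particleSpace {n : ℕ} {x : F} (hx : x ∈ R.particleSpace n) :
    Summable (R.dGammaTerm e B x) :=
  R.summable_cre_ann (fun j => B (e j)) (fun j => J.toMap (e j)) hx (K := n * ‖B‖ ^ 2)
    (by positivity) (fun _ hy => R.sum_norm_ann_op_sq_le e.orthonormal B hy)
    (R.sum_norm_ann_sq_le e.orthonormal hx)

/-- This is the series of termwise adjoints of `dΓ(B)`; its convergence places finite particle
vectors in the domain of `dΓ(B)*`. -/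
theorem summable_adjoint_dGammaTerm_of_mem_particleSpace {n : ℕ} {x : F}
    (hx : x ∈ R.particleSpace n) :
    Summable fun j => R.cre (e j) (R.ann (J.toMap (B (e j))) x) :=
  R.summable_cre_ann e (fun j => J.toMap (B (e j))) hx (K := n) (by positivity)
    (fun _ hy => R.sum_norm_ann_sq_le e.orthonormal hy)
    (R.sum_norm_ann_op_sq_le e.orthonormal B hx)

theorem summable_dGammaTerm {x : F} (hx : x ∈ R.finiteParticle) :
    Summable (R.dGammaTerm e B x) := by
  refine Submodule.iSup_induction _ (motive := fun x => Summable (R.dGammaTerm e B x)) hx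
    (fun n x hx => R.summable_dGammaTerm_of_mem_particleSpace e B hx) ?_ fun x y hx hy => ?_
  · rw [dGammaTerm_zero]; exact summable_zero
  · rw [dGammaTerm_add]; exact hx.add hy

theorem summable_adjoint_dGammaTerm {x : F} (hx : x ∈ R.finiteParticle) :
    Summable fun j => R.cre (e j) (R.ann (J.toMap (B (e j))) x) := by
  refine Submodule.iSup_induction _
    (motive := fun x => Summable fun j => R.cre (e j) (R.ann (J.toMap (B (e j))) x)) hx
    (fun n x hx => R.summable_adjoint_dGammaTerm_of_mem_particleSpace e B hx) ?_
    fun x y hx hy => ?_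
  · simp
  · simpa using hx.add hy

theorem dGamma_domain : (R.dGamma e B).domain = R.finiteParticle :=
  le_antisymm (fun _ h => h.1) fun _ h => ⟨h, R.summable_dGammaTerm e B h⟩

/-- The second quantization `dΓ(B)` as a function on `F`. -/
noncomputable def dGammaFun (x : F) : F := ∑' j, R.dGammaTerm e B x j

variable {e B}

theorem hasSum_dGammaFun {x : F} (hx : x ∈ R.finiteParticle) :
    HasSum (R.dGammaTerm e B x) (R.dGammaFun e B x) := (R.summable_dGammaTerm e B hx).hasSum

theorem dGammaFun_sub {x y : F} (hx : x ∈ R.finiteParticle) (hy : y ∈ R.finiteParticle) :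
    R.dGammaFun e B (x - y) = R.dGammaFun e B x - R.dGammaFun e B y := by
  refine ((R.hasSum_dGammaFun (sub_mem hx hy)).unique ?_)
  refine ((R.hasSum_dGammaFun hx).sub (R.hasSum_dGammaFun hy)).congr_fun fun j => ?_
  simp [dGammaTerm]

theorem dGammaFun_sum {κ : Type*} (t : Finset κ) {c : κ → F} (hc : ∀ k, c k ∈ R.finiteParticle) :
    R.dGammaFun e B (∑ k ∈ t, c k) = ∑ k ∈ t, R.dGammaFun e B (c k) := by
  refine ((R.hasSum_dGammaFun (sum_mem fun k _ => hc k)).unique ?_)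
  refine (hasSum_sum fun k _ => R.hasSum_dGammaFun (hc k)).congr_fun fun j => ?_
  simp [dGammaTerm, map_sum]

theorem dGammaFun_mem {n : ℕ} {x : F} (hx : x ∈ R.particleSpace n) :
    R.dGammaFun e B x ∈ R.particleSpace n :=
  (R.isClosed_particleSpace n).mem_of_tendsto (R.hasSum_dGammaFun (R.mem_finiteParticle hx))
    (Filter.Eventually.of_forall fun _ => sum_mem fun _ _ => R.cre_ann_mem _ _ hx)

theorem norm_dGammaFun_le {n : ℕ} {x : F} (hx : x ∈ R.particleSpace n) :
    ‖R.dGammaFun e B x‖ ≤ n * ‖B‖ * ‖x‖ :=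
  le_of_tendsto (R.hasSum_dGammaFun (R.mem_finiteParticle hx)).norm
    (Filter.Eventually.of_forall fun t => R.norm_sum_dGammaTerm_le e B hx t)

/-- A bound for `dΓ(B)` on the algebraic `n`-particle space extends to its closure. -/
theorem norm_dGammaFun_le_of_forall {n : ℕ} {K : ℝ}
    (h : ∀ x ∈ R.algParticleSpace n, ‖R.dGammaFun e B x‖ ≤ K * ‖x‖) {x : F}
    (hx : x ∈ R.particleSpace n) : ‖R.dGammaFun e B x‖ ≤ K * ‖x‖ := by
  -- With `x` fixed the condition is closed in the approximant `u`, so no continuity of `dΓ(B)` is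
  -- required; `u = x` gives the claim.
  have key := R.particleSpace_induction
    (p := fun u => ‖R.dGammaFun e B x‖ ≤ n * ‖B‖ * ‖x - u‖ + K * ‖u‖)
    (isClosed_le (by fun_prop) (by fun_prop)) (fun u hu => ?_) hx
  · simpa using key
  have hu' := R.algParticleSpace_le n hu
  have h1 := R.norm_dGammaFun_le (e := e) (B := B) (sub_mem hx hu')
  rw [R.dGammaFun_sub (R.mem_finiteParticle hx) (R.mem_finiteParticle hu')] at h1
  calc _ = ‖(R.dGammaFun e B x - R.dGammaFun e B u) + R.dGammaFun e B u‖ := by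
        rw [sub_add_cancel]
    _ ≤ _ := (norm_add_le _ _).trans (add_le_add h1 (h u hu))

/-! ### Eigenspaces of the number operator and orthogonality -/

theorem number_eq_smul {n : ℕ} {x : F} (hx : x ∈ R.particleSpace n) :
    R.dGammaFun e (ContinuousLinearMap.id ℂ L) x = (n : ℂ) • x := by
  have key := R.particleSpace_induction
    (p := fun u => ‖R.dGammaFun e (ContinuousLinearMap.id ℂ L) x - (n : ℂ) • x‖
      ≤ n * ‖ContinuousLinearMap.id ℂ L‖ * ‖x - u‖ + n * ‖x - u‖)
    (isClosed_le (by fun_prop) (by fun_prop)) (fun u hu => ?_) hx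
  · rw [sub_self, norm_zero, mul_zero, mul_zero, add_zero] at key
    exact sub_eq_zero.1 (norm_le_zero_iff.1 key)
  have hu' := R.algParticleSpace_le n hu
  have h1 := R.norm_dGammaFun_le (e := e) (B := ContinuousLinearMap.id ℂ L) (sub_mem hx hu')
  rw [R.dGammaFun_sub (R.mem_finiteParticle hx) (R.mem_finiteParticle hu')] at h1
  have h2 : R.dGammaFun e (ContinuousLinearMap.id ℂ L) u = (n : ℂ) • u :=
    (R.hasSum_dGammaFun (R.mem_finiteParticle hu')).unique
      (R.hasSum_number_of_mem_algParticleSpace e hu)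
  rw [h2] at h1
  calc _ = ‖(R.dGammaFun e (ContinuousLinearMap.id ℂ L) x - (n : ℂ) • u)
          - (n : ℂ) • (x - u)‖ := by
        congr 1
        module
    _ ≤ _ := (norm_sub_le _ _).trans (add_le_add h1 (by rw [norm_smul]; simp))

theorem inner_dGammaFun {x y : F} (hx : x ∈ R.finiteParticle) (hy : y ∈ R.finiteParticle) :
    inner ℂ (∑' j, R.cre (e j) (R.ann (J.toMap (B (e j))) x)) y
      = inner ℂ x (R.dGammaFun e B y) := by
  have h1 := (innerSL ℂ x).hasSum (R.hasSum_dGammaFun (e := e) (B := B) hy)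
  have h2 := (innerSLFlip ℂ y).hasSum (R.summable_adjoint_dGammaTerm e B hx).hasSum
  refine h2.unique (h1.congr_fun fun j => ?_)
  simp only [innerSL_apply_apply, innerSLFlip_apply_apply, dGammaTerm]
  rw [CARRep.inner_cre_left, CARRep.inner_cre_right]

/-- Eigenvectors of the symmetric operator `N` for distinct eigenvalues are orthogonal. -/
theorem inner_eq_zero_of_ne {m n : ℕ} (hmn : m ≠ n) {x y : F} (hx : x ∈ R.particleSpace m)
    (hy : y ∈ R.particleSpace n) : inner ℂ x y = 0 := by
  obtain ⟨w, e, -⟩ := exists_hilbertBasis ℂ L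
  have h := R.inner_dGammaFun (e := e) (B := ContinuousLinearMap.id ℂ L)
    (R.mem_finiteParticle hx) (R.mem_finiteParticle hy)
  have h1 : ∑' j, R.cre (e j) (R.ann (J.toMap (ContinuousLinearMap.id ℂ L (e j))) x)
      = (m : ℂ) • x := R.number_eq_smul (e := e) hx
  rw [h1, R.number_eq_smul hy, inner_smul_left, inner_smul_right, Complex.conj_natCast] at h
  by_contra h0
  exact hmn (Nat.cast_injective (mul_right_cancel₀ h0 h))

theorem norm_sum_sq_eq (t : Finset ℕ) {c : ℕ → F} (hc : ∀ n, c n ∈ R.particleSpace n) :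
    ‖∑ n ∈ t, c n‖ ^ 2 = ∑ n ∈ t, ‖c n‖ ^ 2 := by
  have h : inner ℂ (∑ n ∈ t, c n) (∑ n ∈ t, c n) = ∑ n ∈ t, inner ℂ (c n) (c n) := by
    rw [sum_inner]
    refine Finset.sum_congr rfl fun n hn => ?_
    rw [inner_sum, Finset.sum_eq_single_of_mem n hn]
    exact fun m _ hm => R.inner_eq_zero_of_ne hm.symm (hc n) (hc m)
  simp only [inner_self_eq_norm_sq_to_K] at h
  exact_mod_cast h

end FockRep

/-! ### The Schatten norm bound on the `n`-particle spaces -/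

/-- Hölder with exponents `r, q`, where `∑ (αβ)^q ≤ (ab)^(q-1) ∑ αβ ≤ N (ab)^q`: the pointwise
bounds absorb `q-1` powers and Cauchy–Schwarz handles the last. -/
theorem sum_mul_mul_le_of_sum_sq_le {κ : Type*} (t : Finset κ) {s α β : κ → ℝ} {a b N r : ℝ}
    (hr : 1 ≤ r) (hN : 0 ≤ N) (ha : 0 ≤ a) (hb : 0 ≤ b) (hs : ∀ k, 0 ≤ s k) (hα : ∀ k, 0 ≤ α k)
    (hβ : ∀ k, 0 ≤ β k) (hαa : ∀ k, α k ≤ a) (hβb : ∀ k, β k ≤ b)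
    (hα2 : ∑ k ∈ t, α k ^ 2 ≤ N * a ^ 2) (hβ2 : ∑ k ∈ t, β k ^ 2 ≤ N * b ^ 2) :
    ∑ k ∈ t, s k * (α k * β k) ≤ (∑ k ∈ t, s k ^ r) ^ (1 / r) * N ^ (1 - 1 / r) * (a * b) := by
  have hp (k : κ) : α k * β k ≤ a * b := mul_le_mul (hαa k) (hβb k) (hβ k) ha
  have hp0 (k : κ) : 0 ≤ α k * β k := mul_nonneg (hα k) (hβ k)
  -- For `r = 1` the conjugate exponent is infinite and the pointwise bounds suffice; `N^0 = 1` also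
  -- when `N = 0`.
  rcases hr.eq_or_lt with rfl | hr
  · simp only [Real.rpow_one, div_one, sub_self, Real.rpow_zero, mul_one, Finset.sum_mul]
    exact Finset.sum_le_sum fun k _ => mul_le_mul_of_nonneg_left (hp k) (hs k)
  have hsum : ∑ k ∈ t, α k * β k ≤ N * (a * b) := by
    refine (Real.sum_mul_le_sqrt_mul_sqrt _ _ _).trans ?_
    calc _ ≤ √(N * a ^ 2) * √(N * b ^ 2) := by gcongr
      _ = (√N * √N) * (a * b) := by
          rw [Real.sqrt_mul hN, Real.sqrt_mul hN, Real.sqrt_sq ha, Real.sqrt_sq hb]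
          ring
      _ = _ := by rw [Real.mul_self_sqrt hN]
  have hq : r.HolderConjugate (r.conjExponent) := Real.HolderConjugate.conjExponent hr
  set q := r.conjExponent
  have hq0 : 0 < q := hq.symm.pos
  have hM : 0 ≤ a * b := mul_nonneg ha hb
  have hpow (y : ℝ) (hy : 0 ≤ y) : y ^ q = y ^ (q - 1) * y := by
    rw [← Real.rpow_add_one' hy (by simpa using hq0.ne'), sub_add_cancel]
  have hsumq : ∑ k ∈ t, (α k * β k) ^ q ≤ N * (a * b) ^ q := by
    calc ∑ k ∈ t, (α k * β k) ^ q ≤ ∑ k ∈ t, (a * b) ^ (q - 1) * (α k * β k) := by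
          refine Finset.sum_le_sum fun k _ => ?_
          rw [hpow _ (hp0 k)]
          exact mul_le_mul_of_nonneg_right
            (Real.rpow_le_rpow (hp0 k) (hp k) hq.symm.sub_one_pos.le) (hp0 k)
      _ = (a * b) ^ (q - 1) * ∑ k ∈ t, α k * β k := by rw [Finset.mul_sum]
      _ ≤ (a * b) ^ (q - 1) * (N * (a * b)) :=
          mul_le_mul_of_nonneg_left hsum (Real.rpow_nonneg hM _)
      _ = _ := by rw [hpow _ hM]; ring
  have hqr : 1 - 1 / r = 1 / q := by
    have := hq.inv_add_inv_eq_one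
    rw [one_div, one_div]; linarith
  refine (Real.inner_le_Lp_mul_Lq_of_nonneg t hq (fun k _ => hs k) (fun k _ => hp0 k)).trans ?_
  rw [mul_assoc, hqr]
  refine mul_le_mul_of_nonneg_left ?_ (Real.rpow_nonneg
    (Finset.sum_nonneg fun k _ => Real.rpow_nonneg (hs k) _) _)
  refine (Real.rpow_le_rpow (Finset.sum_nonneg fun k _ => Real.rpow_nonneg (hp0 k) _) hsumq
    (by positivity)).trans_eq ?_
  rw [Real.mul_rpow hN (Real.rpow_nonneg hM _), ← Real.rpow_mul hM, mul_one_div_cancel hq0.ne',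
    Real.rpow_one]

theorem inner_self_eq_ofReal_norm_sq {E : Type*} [NormedAddCommGroup E] [InnerProductSpace ℂ E]
    (x : E) : inner ℂ x x = ((‖x‖ ^ 2 : ℝ) : ℂ) := by
  rw [inner_self_eq_norm_sq_to_K]
  norm_cast

theorem inner_apply_apply_of_abs_eigenvector {L : Type*} [NormedAddCommGroup L]
    [InnerProductSpace ℂ L] [CompleteSpace L] {B : L →L[ℂ] L} {x y : L} {c d : ℝ}
    (hx : CFC.abs B x = (c : ℂ) • x) (hy : CFC.abs B y = (d : ℂ) • y) :
    inner ℂ (B x) (B y) = (c * d : ℂ) * inner ℂ x y := by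
  have h : inner ℂ (B x) (B y) = inner ℂ (CFC.abs B x) (CFC.abs B y) := by
    rw [← ContinuousLinearMap.adjoint_inner_right, ← ContinuousLinearMap.star_eq_adjoint,
      ← mul_apply_eq_comp, ← CFC.abs_mul_abs, mul_apply_eq_comp,
      ← ContinuousLinearMap.adjoint_inner_left, ← ContinuousLinearMap.star_eq_adjoint,
      (CFC.abs_nonneg B).isSelfAdjoint.star_eq]
  rw [h, hx, hy, inner_smul_left, inner_smul_right, Complex.conj_ofReal, mul_assoc]

namespace FockRep

variable {L : Type*} [NormedAddCommGroup L] [InnerProductSpace ℂ L] [CompleteSpace L]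
  {J : Conjugation L} {F : Type*} [NormedAddCommGroup F] [InnerProductSpace ℂ F] [CompleteSpace F]
  (R : FockRep J F) {ι : Type*} {e : HilbertBasis ι ℂ L} {B : L →L[ℂ] L}

theorem sum_norm_ann_mul_norm_ann_le {κ : Type*} (v : HilbertBasis κ ℂ L) {s : κ → ℝ}
    (hs : ∀ k, 0 ≤ s k) (hv : ∀ k, CFC.abs B (v k) = (s k : ℂ) • v k) {r : ℝ} (hr : 1 ≤ r) {n : ℕ}
    {x y : F} (hx : x ∈ R.particleSpace n) (hy : y ∈ R.particleSpace n) (t : Finset κ) :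
    ∑ k ∈ t, ‖R.ann (J.toMap (B (v k))) y‖ * ‖R.ann (J.toMap (v k)) x‖
      ≤ (∑ k ∈ t, s k ^ r) ^ (1 / r) * (n : ℝ) ^ (1 - 1 / r) * (‖y‖ * ‖x‖) := by
  classical
  -- These are the left singular vectors. Since `0⁻¹ = 0`, they vanish where `s k = 0`, so
  -- orthonormality is claimed only on the remaining indices.
  let u : κ → L := fun k => ((s k : ℂ)⁻¹) • B (v k)
  have hB (k : κ) : B (v k) = (s k : ℂ) • u k := by
    rcases eq_or_ne (s k) 0 with h | h
    · have h1 := inner_apply_apply_of_abs_eigenvector (hv k) (hv k)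
      rw [h, Complex.ofReal_zero, zero_mul, zero_mul, inner_self_eq_zero] at h1
      rw [h, h1, Complex.ofReal_zero, zero_smul]
    · exact (smul_inv_smul₀ (Complex.ofReal_ne_zero.2 h) _).symm
  have hu : Orthonormal ℂ fun k : {k // s k ≠ 0} => u k := by
    rw [orthonormal_iff_ite]
    intro k l
    have hk := Complex.ofReal_ne_zero.2 k.2
    have hl := Complex.ofReal_ne_zero.2 l.2
    simp only [u]
    rw [inner_smul_left, inner_smul_right, inner_apply_apply_of_abs_eigenvector (hv k) (hv l),
      orthonormal_iff_ite.1 v.orthonormal, map_inv₀, Complex.conj_ofReal]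
    by_cases hkl : k = l
    · subst hkl
      simp
      field_simp
    · rw [if_neg hkl, if_neg (fun h => hkl (Subtype.ext h))]
      simp
  have hu0 (k : κ) (hk : ¬ s k ≠ 0) : u k = 0 := by
    simp only [u]
    rw [not_not.1 hk]; simp
  have hule (k : κ) : ‖u k‖ ≤ 1 := by
    by_cases hk : s k ≠ 0
    · exact (hu.1 ⟨k, hk⟩).le
    · rw [hu0 k hk]; simp
  have hα2 : ∑ k ∈ t, ‖R.ann (J.toMap (u k)) y‖ ^ 2 ≤ n * ‖y‖ ^ 2 := by
    have h := R.sum_norm_ann_sq_le hu hy (t.subtype fun k => s k ≠ 0)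
    rw [Finset.sum_subtype_eq_sum_filter (f := fun k => ‖R.ann (J.toMap (u k)) y‖ ^ 2)] at h
    rw [Finset.sum_filter_of_ne] at h
    · exact h
    · intro k _ hk hk0
      apply hk
      have h1 := hu0 k (not_not.2 hk0)
      have h2 : R.ann 0 y = 0 := map_zero (R.annCLM y)
      rw [h1, map_zero, h2, norm_zero, sq, zero_mul]
  have hle (f : L) (hf : ‖f‖ ≤ 1) (z : F) : ‖R.ann (J.toMap f) z‖ ≤ ‖z‖ := by
    refine (R.norm_ann_apply_le _ _).trans ?_
    rw [J.toMap.norm_map]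
    exact mul_le_of_le_one_left (norm_nonneg _) hf
  refine le_trans (le_of_eq ?_) (sum_mul_mul_le_of_sum_sq_le t hr (Nat.cast_nonneg n)
    (norm_nonneg y) (norm_nonneg x) hs (fun k => norm_nonneg (R.ann (J.toMap (u k)) y))
    (fun k => norm_nonneg (R.ann (J.toMap (v k)) x)) (fun k => hle _ (hule k) y)
    (fun k => hle _ (v.orthonormal.1 k).le x) hα2 (R.sum_norm_ann_sq_le v.orthonormal hx t))
  refine Finset.sum_congr rfl fun k _ => ?_
  rw [hB k, map_smulₛₗ, CARRep.ann_smul, norm_smul, Complex.conj_ofReal, Complex.norm_real,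
    Real.norm_of_nonneg (hs k), mul_assoc]

theorem norm_dGammaFun_le_schattenNorm {r : ℝ≥0∞} (hr : 1 ≤ r) (hr' : r ≠ ⊤)
    (hB : MemSchatten r B) {n : ℕ} {x : F} (hx : x ∈ R.particleSpace n) :
    ‖R.dGammaFun e B x‖ ≤ schattenNorm r B * (n : ℝ) ^ (1 - 1 / r.toReal) * ‖x‖ := by
  have hr0 : r ≠ 0 := (zero_lt_one.trans_le hr).ne'
  have hr1 : 1 ≤ r.toReal := by
    simpa using ENNReal.toReal_mono hr' hr
  obtain ⟨κ, v, s, hs, hv⟩ := hB.exists_eigenbasis_abs hr0 hr'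
  obtain ⟨hsum, hnorm⟩ := hB.summable_rpow hr0 hr' v hs hv
  have hK : 0 ≤ schattenNorm r B := ENNReal.toReal_nonneg
  -- Reduction to the algebraic span, where the basis `e` may be replaced by the singular basis `v`.
  refine R.norm_dGammaFun_le_of_forall (fun x hx => ?_) hx
  obtain ⟨y, hey, hvy⟩ := R.exists_hasSum_dGammaTerm e v B hx
  rw [dGammaFun, hey.tsum_eq]
  refine le_of_tendsto hvy.norm (Filter.Eventually.of_forall fun t => ?_)
  have hx' := R.algParticleSpace_le n hx
  refine R.norm_sum_cre_ann_le_of_inner_le (fun k => B (v k)) (fun k => J.toMap (v k)) hx' t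
    (by positivity) fun z hz => ?_
  refine (R.sum_norm_ann_mul_norm_ann_le v hs hv hr1 hx' hz t).trans ?_
  rw [mul_assoc _ ‖x‖ ‖z‖, mul_comm ‖x‖, hnorm]
  have hnn : ∀ k, 0 ≤ s k ^ r.toReal := fun k => Real.rpow_nonneg (hs k) _
  refine mul_le_mul_of_nonneg_right (mul_le_mul_of_nonneg_right ?_ (by positivity)) (by positivity)
  exact Real.rpow_le_rpow (Finset.sum_nonneg fun k _ => hnn k)
    (hsum.sum_le_tsum t fun k _ => hnn k) (by positivity)

theorem norm_dGammaFun_sq_le {r : ℝ≥0∞} (hr : 1 ≤ r) (hB : MemSchatten r B) {n : ℕ} {x : F}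
    (hx : x ∈ R.particleSpace n) :
    ‖R.dGammaFun e B x‖ ^ 2
      ≤ schattenNorm r B ^ 2 * ((n : ℝ) ^ numberExponent r * ‖x‖ ^ 2) := by
  have hK : 0 ≤ schattenNorm r B := ENNReal.toReal_nonneg
  by_cases hr' : r = ⊤
  · have h := R.norm_dGammaFun_le (e := e) (B := B) hx
    have h1 : schattenNorm r B = ‖B‖ := by simp [schattenNorm, schattenENorm, hr']
    have h2 : (n : ℝ) ^ numberExponent r = (n : ℝ) ^ 2 := by
      rw [numberExponent, if_pos hr', Real.rpow_two]
    rw [h1, h2]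
    calc _ ≤ (n * ‖B‖ * ‖x‖) ^ 2 := by gcongr
      _ = _ := by ring
  · have h := R.norm_dGammaFun_le_schattenNorm (e := e) hr hr' hB hx
    have hr0 : 0 < r.toReal := ENNReal.toReal_pos (zero_lt_one.trans_le hr).ne' hr'
    have h2 : (n : ℝ) ^ numberExponent r = ((n : ℝ) ^ (1 - 1 / r.toReal)) ^ 2 := by
      rw [numberExponent, if_neg hr', ← Real.rpow_natCast, ← Real.rpow_mul (Nat.cast_nonneg n)]
      congr 1
      push_cast
      field_simp
    rw [h2]
    calc _ ≤ (schattenNorm r B * (n : ℝ) ^ (1 - 1 / r.toReal) * ‖x‖) ^ 2 := by gcongr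
      _ = _ := by ring

/-! ### Powers of the number operator and the form `dΓ(B)* dΓ(B)` -/

theorem dGammaFun_mem_finiteParticle {x : F} (hx : x ∈ R.finiteParticle) :
    R.dGammaFun e B x ∈ R.finiteParticle := by
  obtain ⟨t, c, hc, rfl⟩ := R.exists_sum_of_mem_finiteParticle hx
  rw [R.dGammaFun_sum t fun n => R.mem_finiteParticle (hc n)]
  exact sum_mem fun n _ => R.mem_finiteParticle (R.dGammaFun_mem (hc n))

/-- As `dΓ(B) x` again has finite particle number, the termwise adjoint series applied to it
supplies the representing vector. -/
theorem dGammaFun_mem_adjoint_domain {x : F} (hx : x ∈ R.finiteParticle) :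
    R.dGammaFun e B x ∈ (R.dGamma e B)†.domain :=
  LinearPMap.mem_adjoint_domain_of_exists _ ⟨_, fun y =>
    R.inner_dGammaFun (R.dGammaFun_mem_finiteParticle hx) y.2.1⟩

theorem finiteParticle_le_domain_adjoint_mul :
    R.finiteParticle ≤ (pmapMul (R.dGamma e B)† (R.dGamma e B)).domain := fun x hx =>
  have hx' : x ∈ (R.dGamma e B).domain := (R.dGamma_domain e B).symm ▸ hx
  ⟨⟨⟨x, hx'⟩, R.dGammaFun_mem_adjoint_domain hx, rfl⟩, hx'⟩

theorem inner_adjoint_mul {x : F} (hx : x ∈ R.finiteParticle)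
    (hx' : x ∈ (pmapMul (R.dGamma e B)† (R.dGamma e B)).domain) :
    inner ℂ x (pmapMul (R.dGamma e B)† (R.dGamma e B) ⟨x, hx'⟩)
      = ((‖R.dGammaFun e B x‖ ^ 2 : ℝ) : ℂ) := by
  have hd : Dense ((R.dGamma e B).domain : Set F) := by
    rw [R.dGamma_domain]; exact R.dense_finiteParticle
  have h1 : x ∈ (R.dGamma e B).domain := (R.dGamma_domain e B).symm ▸ hx
  have h := LinearPMap.adjoint_isFormalAdjoint hd
    ⟨R.dGammaFun e B x, R.dGammaFun_mem_adjoint_domain hx⟩ ⟨x, h1⟩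
  have h2 : pmapMul (R.dGamma e B)† (R.dGamma e B) ⟨x, hx'⟩
      = (R.dGamma e B)† ⟨R.dGammaFun e B x, R.dGammaFun_mem_adjoint_domain hx⟩ := rfl
  rw [h2, ← inner_conj_symm, h]
  change starRingEnd ℂ (inner ℂ (R.dGammaFun e B x) (R.dGammaFun e B x)) = _
  rw [inner_conj_symm, inner_self_eq_ofReal_norm_sq]

variable (e) in
/-- The graph of the power `N^s` of the number operator. -/
def numberPowGraph (s : ℝ) : Submodule ℂ (F × F) :=
  Submodule.span ℂ {p : F × F | ∃ (c : ℝ) (x : (R.number e).domain), 0 ≤ c ∧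
    R.number e x = (c : ℂ) • (x : F) ∧ p = ((x : F), ((c ^ s : ℝ) : ℂ) • (x : F))}

/-- By symmetry of `N`, an eigenvector with eigenvalue `c` can have nonzero inner product with `z`
only if `c = n`. This determines the second entry from the first and computes the form of `N^s`. -/
theorem inner_snd_of_mem_numberPowGraph {s : ℝ} {p : F × F} (hp : p ∈ R.numberPowGraph e s)
    {n : ℕ} {z : F} (hz : z ∈ R.particleSpace n) :
    inner ℂ z p.2 = (((n : ℝ) ^ s : ℝ) : ℂ) * inner ℂ z p.1 := by
  induction hp using Submodule.span_induction with
  | mem p h =>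
    obtain ⟨c, x, -, hx, rfl⟩ := h
    have h := R.inner_dGammaFun (e := e) (B := ContinuousLinearMap.id ℂ L)
      (R.mem_finiteParticle hz) x.2.1
    have h1 : ∑' j, R.cre (e j) (R.ann (J.toMap (ContinuousLinearMap.id ℂ L (e j))) z)
        = (n : ℂ) • z := R.number_eq_smul (e := e) hz
    have h2 : R.dGammaFun e (ContinuousLinearMap.id ℂ L) (x : F) = (c : ℂ) • (x : F) := hx
    rw [h1, h2, inner_smul_left, inner_smul_right, Complex.conj_natCast] at h
    change inner ℂ z (((c ^ s : ℝ) : ℂ) • (x : F)) = _ * inner ℂ z (x : F)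
    rw [inner_smul_right]
    by_cases h0 : inner ℂ z (x : F) = 0
    · rw [h0, mul_zero, mul_zero]
    · have h3 : (n : ℝ) = c := by exact_mod_cast mul_right_cancel₀ h0 h
      rw [h3]
  | zero => simp
  | add p q _ _ hp hq =>
    rw [Prod.snd_add, Prod.fst_add, inner_add_right, inner_add_right, hp, hq, mul_add]
  | smul c p _ hp =>
    rw [Prod.smul_snd, Prod.smul_fst, inner_smul_right, inner_smul_right, hp]; ring

/-- Single-valuedness, needed for `toLinearPMap` to have the span as its graph. -/
theorem snd_eq_zero_of_mem_numberPowGraph {s : ℝ} (p : F × F) (hp : p ∈ R.numberPowGraph e s)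
    (h : p.1 = 0) : p.2 = 0 := by
  refine R.dense_finiteParticle.eq_zero_of_inner_right ℂ fun z hz => ?_
  obtain ⟨t, c, hc, rfl⟩ := R.exists_sum_of_mem_finiteParticle hz
  rw [sum_inner]
  refine Finset.sum_eq_zero fun n _ => ?_
  rw [R.inner_snd_of_mem_numberPowGraph hp (hc n), h, inner_zero_right, mul_zero]

theorem sum_mem_numberPowGraph (s : ℝ) (t : Finset ℕ) {c : ℕ → F}
    (hc : ∀ n, c n ∈ R.particleSpace n) :
    (∑ n ∈ t, c n, ∑ n ∈ t, (((n : ℝ) ^ s : ℝ) : ℂ) • c n) ∈ R.numberPowGraph e s := by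
  have h : (∑ n ∈ t, c n, ∑ n ∈ t, (((n : ℝ) ^ s : ℝ) : ℂ) • c n)
      = ∑ n ∈ t, (c n, (((n : ℝ) ^ s : ℝ) : ℂ) • c n) := by
    ext <;> simp [Prod.fst_sum, Prod.snd_sum]
  rw [h]
  refine sum_mem fun n _ => Submodule.subset_span ?_
  have hn : c n ∈ (R.number e).domain :=
    (R.dGamma_domain e (ContinuousLinearMap.id ℂ L)).symm ▸ R.mem_finiteParticle (hc n)
  have hN : R.number e ⟨c n, hn⟩ = ((n : ℝ) : ℂ) • c n := by
    rw [Complex.ofReal_natCast]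
    exact R.number_eq_smul (hc n)
  exact ⟨n, ⟨c n, hn⟩, Nat.cast_nonneg n, hN, rfl⟩

theorem finiteParticle_le_domain_numberPow (s : ℝ) :
    R.finiteParticle ≤ (pmapPow (R.number e) s).domain := by
  intro x hx
  obtain ⟨t, c, hc, rfl⟩ := R.exists_sum_of_mem_finiteParticle hx
  exact ⟨_, R.sum_mem_numberPowGraph s t hc, rfl⟩

theorem inner_numberPow {s : ℝ} (t : Finset ℕ) {c : ℕ → F} (hc : ∀ n, c n ∈ R.particleSpace n)
    (hx : ∑ n ∈ t, c n ∈ (pmapPow (R.number e) s).domain) :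
    inner ℂ (∑ n ∈ t, c n) (pmapPow (R.number e) s ⟨∑ n ∈ t, c n, hx⟩)
      = ((∑ n ∈ t, (n : ℝ) ^ s * ‖c n‖ ^ 2 : ℝ) : ℂ) := by
  have hmem : (∑ n ∈ t, c n, pmapPow (R.number e) s ⟨∑ n ∈ t, c n, hx⟩) ∈ R.numberPowGraph e s :=
    Submodule.mem_graph_toLinearPMap R.snd_eq_zero_of_mem_numberPowGraph ⟨_, hx⟩
  rw [sum_inner, Complex.ofReal_sum]
  refine Finset.sum_congr rfl fun n hn => ?_
  have h := R.inner_snd_of_mem_numberPowGraph hmem (hc n)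
  simp only at h
  rw [h, inner_sum, Finset.sum_eq_single_of_mem n hn
    fun m _ hm => R.inner_eq_zero_of_ne hm.symm (hc n) (hc m), inner_self_eq_ofReal_norm_sq,
    Complex.ofReal_mul]

/-- The bound for `dΓ(B)* dΓ(B)` on the finite particle vectors, without an additional term. -/
theorem inner_adjoint_mul_le {r : ℝ≥0∞} (hr : 1 ≤ r) (hB : MemSchatten r B) {x : F}
    (hx : x ∈ R.finiteParticle) :
    inner ℂ x (pmapMul (R.dGamma e B)† (R.dGamma e B)
        ⟨x, R.finiteParticle_le_domain_adjoint_mul hx⟩)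
      ≤ ((schattenNorm r B ^ 2 : ℝ) : ℂ) * inner ℂ x (pmapPow (R.number e) (numberExponent r)
        ⟨x, R.finiteParticle_le_domain_numberPow (numberExponent r) hx⟩) := by
  rw [R.inner_adjoint_mul hx]
  -- Both forms are diagonal in the particle number, so the inequality is compared component by
  -- component.
  obtain ⟨t, c, hc, rfl⟩ := R.exists_sum_of_mem_finiteParticle hx
  rw [R.inner_numberPow t hc, ← Complex.ofReal_mul, Complex.real_le_real,
    R.dGammaFun_sum t fun n => R.mem_finiteParticle (hc n),
    R.norm_sum_sq_eq t fun n => R.dGammaFun_mem (hc n), Finset.mul_sum]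
  exact Finset.sum_le_sum fun n _ => R.norm_dGammaFun_sq_le hr hB (hc n)

end FockRep

/-! ### The operator inequality -/

theorem theorem3 {L : Type*} [NormedAddCommGroup L] [InnerProductSpace ℂ L] [CompleteSpace L]
    [TopologicalSpace.SeparableSpace L] (J : Conjugation L)
    {F : Type*} [NormedAddCommGroup F] [InnerProductSpace ℂ F] [CompleteSpace F]
    (R : FockRep J F) {ι : Type*} (e : HilbertBasis ι ℂ L)
    (r : ℝ≥0∞) (hr : 1 ≤ r) (B : L →L[ℂ] L) (hB : MemSchatten r B) :
    (1 < r ∧ r < 2 →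
      MemSchatten 2 B ∧
      OpLEOn R.finiteParticle
        (pmapMul (R.dGamma e B)† (R.dGamma e B))
        (((schattenNorm r B ^ 2 : ℝ) : ℂ) • pmapPow (R.number e) (numberExponent r) +
          ((schattenNorm 2 B ^ 2 : ℝ) : ℂ) • (LinearMap.id : F →ₗ[ℂ] F).toPMap ⊤)) ∧
    (r = 1 ∨ 2 ≤ r →
      OpLEOn R.finiteParticle
        (pmapMul (R.dGamma e B)† (R.dGamma e B))
        (((schattenNorm r B ^ 2 : ℝ) : ℂ) • pmapPow (R.number e) (numberExponent r))) := by
  have hS := R.finiteParticle_le_domain_adjoint_mul (e := e) (B := B)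
  have hN := R.finiteParticle_le_domain_numberPow (e := e) (numberExponent r)
  refine ⟨fun h => ⟨hB.mono (zero_lt_one.trans_le hr).ne' h.2.le ENNReal.ofNat_ne_top,
    hS, fun x hx => ⟨hN hx, Submodule.mem_top⟩, fun x => ?_⟩, fun _ => ⟨hS, hN, fun x => ?_⟩⟩
  -- The bound already holds without the `‖B‖_2²` term, whose form is nonnegative.
  · refine (R.inner_adjoint_mul_le hr hB x.2).trans ?_
    rw [LinearPMap.add_apply, inner_add_right, LinearPMap.smul_apply, inner_smul_right]
    refine le_add_of_nonneg_right ?_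
    rw [LinearPMap.smul_apply, inner_smul_right]
    change 0 ≤ _ * inner ℂ (x : F) (x : F)
    rw [inner_self_eq_ofReal_norm_sq, ← Complex.ofReal_mul, Complex.zero_le_real]
    positivity
  · rw [LinearPMap.smul_apply, inner_smul_right]
    exact R.inner_adjoint_mul_le hr hB x.2
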